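/- **Setting.** $\mathcal A$ (actions) and $\mathcal Y$ (states, nonempty) are finite, $\mathcal P$ is a set of policies, $\mathcal P_0\subseteq\mathcal P$ is a finite nonempty set of benchmark policies. The Agent's and the Principal's utilities are $U(a,p,y),V(a,p,y)\in[-1,1]$; for $\pi\in\Delta(\mathcal Y)$ let $U(a,p,\pi)=\mathbb E_{y\sim\pi}U(a,p,y)$, and similarly for $V$ and for distributions over actions. Ties in the following choices are broken arbitrarily: $a^*(p,\pi)$ maximizes $V(\cdot,p,\pi)$ among the maximizers of $U(\cdot,p,\pi)$; $a^*(p,\pi,\epsilon)$ maximizes $V(\cdot,p,\pi)$ among the actions $a$ with $U(a,p,\pi)\ge U(a^*(p,\pi),p,\pi)-\epsilon$; $p^{\mathrm{opt}}(\pi)$ maximizes $V(a^*(p_0,\pi,\epsilon),p_0,\pi)$ over $p_0\in\mathcal P_0$, and $a^{\mathrm{opt}}(\pi)=a^*(p^{\mathrm{opt}}(\pi),\pi,\epsilon)$. Let $c\in\mathbb R$, $\epsilon>0$, $0<\beta\le 2$, $\gamma\ge 0$. A $(c,\epsilon,\beta,\gamma)$-optimal stable policy oracle is a map $\mathcal O:\Delta(\mathcal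 Y)\to\mathcal P_{\mathcal O}$, with $\mathcal P_{\mathcal O}\subseteq\mathcal P$ finite, such that for every $\pi$ the policy $p=\mathcal O(\pi)$ satisfies: for each $a\ne a^*(p,\pi)$, $U(a,p,\pi)\le U(a^*(p,\pi),p,\pi)-\beta$ or $V(a,p,\pi)\ge V(a^*(p,\pi),p,\pi)-\gamma$; and $V(a^*(p,\pi),p,\pi)\ge V(a^*(p_0,\pi,\epsilon),p_0,\pi)-c$ for all $p_0\in\mathcal P_0$. **Interaction.** In each of $T\ge1$ rounds a randomized forecaster, seeing past states and past forecasts, draws a forecast $\pi_t$ (from a discrete distribution on $\Delta(\mathcal Y)$); the Principal announces $p_t$ and the recommendation $r_t=a^*(p_t,\pi_t)$; the Agent draws $a_t\sim\mathcal L_t(y_{1:t-1},a_{1:t-1},r_{1:t},p_{1:t})$; the state $y_t$ is revealed. For forecasts $\pi_{1:T}$ let $a_{1:T}$ be the actions under $p_t=\mathcal O(\pi_t)$ and $a^{p_0}_{1:T}$ those under $p_t\equiv p_0$ (with recommendations $a^*(p_0,\pi_t)$), and let $$\mathrm{PR}(\mathcal O,\pi_{1:T},\mathcal L,y_{1:T})=\max_{p_0\in\mathcal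 P_0}\mathbb E\Big[\tfrac1T\sum_{t=1}^T\big(V(a^{p_0}_t,p_0,y_t)-V(a_t,p_t,y_t)\big)\Big].$$ The policy regret $\mathrm{PR}(\mathcal F,\mathcal O,\mathcal L,y_{1:T})$ of the forecaster $\mathcal F$ with $\mathcal O$ is the expectation of this over the forecasts. **Behavioral assumptions** for $(\mathcal L,y_{1:T},\pi_{1:T})$ with parameters $\epsilon_{\mathrm{swap}}$ and $K$, required both for $p_t=\mathcal O(\pi_t)$ and for $p_t\equiv p_0$, for every $p_0\in\mathcal P_0$. *No contextual swap regret:* $\mathbb E\big[\max_{h:\mathcal P\times\mathcal A\times\mathcal A\to\mathcal A}\frac1T\sum_t\big(U(h(p_t,r_t,a_t),p_t,y_t)-U(a_t,p_t,y_t)\big)\big]\le\epsilon_{\mathrm{swap}}$. *No secret information:* for all $(p,r)$, with $n$ the number of rounds $t$ with $(p_t,r_t)=(p,r)$ and $\hat\mu$ the empirical distribution of the actions in these rounds, $\frac1n\mathbb E\big|\sum_{t:(p_t,r_t)=(p,r)}(W(a_t,p,y_t)-W(\hat\mu,p,y_t))\big|\le K/\sqrt n$ for $W=U$ and $W=V$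 whenever $n\geq 1$. **Events and bias.** Let $\mathcal E=\mathcal E_1\cup\mathcal E_2\cup\mathcal E_3$, where $\mathcal E_1$ consists of the events $(\mathcal O(\pi),a^*(\mathcal O(\pi),\pi))=(p,r)$ for $p\in\mathcal P_{\mathcal O},r\in\mathcal A$; $\mathcal E_2$ of the events $(p^{\mathrm{opt}}(\pi),a^{\mathrm{opt}}(\pi))=(p,a)$ for $p\in\mathcal P_0,a\in\mathcal A$; and $\mathcal E_3=\bigcup_{p_0\in\mathcal P_0}\mathcal E_{3,p_0}$, where $\mathcal E_{3,p_0}$ consists of the events $a^*(p_0,\pi)=a$ for $a\in\mathcal A$ (an event is a function $E:\Delta(\mathcal Y)\to\{0,1\}$). The bias conditional on $E$ is $\mathrm{bias}(E)=\frac1T\|\sum_tE(\pi_t)(\pi_t-y_t)\|_1$, with states in one-hot encoding, and $n_E=|\{t:E(\pi_t)=1\}|$. A forecaster has the *bias guarantee for $\mathcal E$ with constant $\kappa$* if, with $\ell=\ln(|\mathcal Y||\mathcal E|T)$, for every $y_{1:T}$, $$\mathbb E\Big[\max_{E\in\mathcal E}\Big(\mathrm{bias}(E)-\frac{\kappa|\mathcal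 Y|\sqrt{\ell\,n_E}}{T}\Big)\Big]\le\frac{\kappa|\mathcal Y|\,\ell}{T}.$$ **Theorem.** There is an absolute constant $\kappa>0$ and, for every $K\ge 0$, a constant $C>0$ depending only on $K$, such that for every game, every $(c,\epsilon,\beta,\gamma)$-optimal stable policy oracle $\mathcal O$ and every $T\ge1$: 1. $|\mathcal E|\le|\mathcal P_{\mathcal O}||\mathcal A|+2|\mathcal P_0||\mathcal A|$, and some forecaster has the bias guarantee for $\mathcal E$ with constant $\kappa$. 2. For every forecaster $\mathcal F$ with the bias guarantee for $\mathcal E$ with constant $\kappa$, every Agent algorithm $\mathcal L$ and every $y_{1:T}$: if both behavioral assumptions, with parameters $\epsilon_{\mathrm{swap}}$ and $K$, hold for every forecast sequence that $\mathcal F$ produces with positive probability on $y_{1:T}$, then, with $\Lambda=1+\ln(T|\mathcal Y||\mathcal P_{\mathcal O}||\mathcal P_0||\mathcal A|)$, $$\mathrm{PR}(\mathcal F,\mathcal O,\mathcal L,y_{1:T})\le c+\gamma+C\left(\Lambda\sqrt{\frac{|\mathcal P_0||\mathcal A|}{T}}+\frac{\epsilon_{\mathrm{swap}}+\Lambda|\mathcal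 Y|\sqrt{|\mathcal P_{\mathcal O}||\mathcal A|/T}}{\beta}+\frac{\epsilon_{\mathrm{swap}}+\Lambda|\mathcal Y|\sqrt{|\mathcal A|/T}}{\epsilon}\right).$$ 3. For every $\mathcal L$, $y_{1:T}$, every fixed forecast sequence $\pi_{1:T}$ for which both behavioral assumptions hold with parameters $\epsilon_{\mathrm{swap}}$ and $K$, and every $\alpha$ with $\mathrm{bias}(E)\le\alpha(E)$ for all $E\in\mathcal E$: writing $\alpha(\mathcal E')=\sum_{E\in\mathcal E'}\alpha(E)$ and $\alpha_3=\max_{p_0\in\mathcal P_0}\alpha(\mathcal E_{3,p_0})$, $$\mathrm{PR}(\mathcal O,\pi_{1:T},\mathcal L,y_{1:T})\le c+3\alpha(\mathcal E_1)+2\alpha(\mathcal E_2)+\alpha_3+\gamma+C\,\frac{\epsilon_{\mathrm{swap}}+\sqrt{|\mathcal P_{\mathcal O}||\mathcal A|/T}+\alpha(\mathcal E_1)}{\beta}+C\,\frac{\epsilon_{\mathrm{swap}}+\sqrt{|\mathcal A|/T}+\alpha_3}{\epsilon}.$$ No alignment assumption is made. -/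

import Mathlib

noncomputable section

namespace PrincipalAgent

/-- The simplex `Δ(Y)` of probability distributions over the finite state space `Y`. -/
abbrev Belief (Y : Type*) [Fintype Y] := ↥(stdSimplex ℝ Y)

/-- Expectation of a (bounded) real function under a discrete probability distribution. -/
def expect {Ω : Type*} (μ : PMF Ω) (f : Ω → ℝ) : ℝ := ∑' x, (μ x).toReal * f x

/-- The stage game: utilities `U` (Agent) and `V` (Principal) with values in `[-1, 1]`, and a
finite nonempty set of benchmark policies. -/
structure Game (P A Y : Type*) where
  /-- Agent's utility `U(a, p, y)` -/
  U : A → P → Y → ℝ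
  /-- Principal's utility `V(a, p, y)` -/
  V : A → P → Y → ℝ
  U_mem : ∀ a p y, U a p y ∈ Set.Icc (-1 : ℝ) 1
  V_mem : ∀ a p y, V a p y ∈ Set.Icc (-1 : ℝ) 1
  /-- the benchmark policies `P₀` -/
  benchmark : Finset P
  benchmark_nonempty : benchmark.Nonempty

section Stage

variable {P A Y : Type*} [Fintype Y]

/-- `U(a, p, π)`: expected utility of the Agent when the state is drawn from `π`. -/
def Game.expU (G : Game P A Y) (a : A) (p : P) (π : Belief Y) : ℝ := ∑ y, π.1 y * G.U a p y

/-- `V(a, p, π)`: expected utility of the Principal when the state is drawn from `π`. -/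
def Game.expV (G : Game P A Y) (a : A) (p : P) (π : Belief Y) : ℝ := ∑ y, π.1 y * G.V a p y

/-- `A*(p, π)`: the best responses of the Agent. -/
def Game.bestResponses (G : Game P A Y) (p : P) (π : Belief Y) : Set A :=
  {a | ∀ b, G.expU b p π ≤ G.expU a p π}

/-- The `ε`-best responses of the Agent, given a best response selection `astar`. -/
def Game.approxResponses (G : Game P A Y) (astar : P → Belief Y → A) (p : P) (π : Belief Y)
    (ε : ℝ) : Set A :=
  {a | G.expU (astar p π) p π - ε ≤ G.expU a p π}

/-- An arbitrary way of resolving the argmax choices: `astar p π` is `a*(p, π)`, `aopt p π` is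
`a*(p, π, ε)`, and `popt π` is the optimistic benchmark policy. -/
structure Selection (G : Game P A Y) (ε : ℝ) where
  /-- `a*(p, π)`: best response of the Agent, ties broken in favor of the Principal -/
  astar : P → Belief Y → A
  astar_mem : ∀ p π, astar p π ∈ G.bestResponses p π
  astar_max : ∀ p π, ∀ a ∈ G.bestResponses p π, G.expV a p π ≤ G.expV (astar p π) p π
  /-- `a*(p, π, ε)`: the `ε`-best response of the Agent that is best for the Principal -/
  aopt : P → Belief Y → A
  aopt_mem : ∀ p π, aopt p π ∈ G.approxResponses astar p π ε
  aopt_max : ∀ p π, ∀ a ∈ G.approxResponses astar p π ε, G.expV a p π ≤ G.expV (aopt p π) p π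
  /-- the optimistic benchmark policy under `π` -/
  popt : Belief Y → P
  popt_mem : ∀ π, popt π ∈ G.benchmark
  popt_max : ∀ π, ∀ p₀ ∈ G.benchmark,
    G.expV (aopt p₀ π) p₀ π ≤ G.expV (aopt (popt π) π) (popt π) π

variable {G : Game P A Y} {ε : ℝ}

/-- The policy `p` is `(β, γ)`-stable under `π`. -/
def Selection.IsStable (S : Selection G ε) (β γ : ℝ) (p : P) (π : Belief Y) : Prop :=
  ∀ a, a ≠ S.astar p π →
    G.expU a p π ≤ G.expU (S.astar p π) p π - β ∨ G.expV (S.astar p π) p π - γ ≤ G.expV a p π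

/-- The policy `p` is a `(c, ε, β, γ)`-optimal stable policy under `π`. -/
def Selection.IsOptimalStable (S : Selection G ε) (c β γ : ℝ) (p : P) (π : Belief Y) : Prop :=
  S.IsStable β γ p π ∧
    ∀ p₀ ∈ G.benchmark, G.expV (S.aopt p₀ π) p₀ π - c ≤ G.expV (S.astar p π) p π

/-- `O` is a `(c, ε, β, γ)`-optimal stable policy oracle with outputs in the finite set `PO`. -/
def Selection.IsOptimalStableOracle (S : Selection G ε) (c β γ : ℝ) (PO : Finset P)
    (O : Belief Y → P) : Prop :=
  ∀ π, O π ∈ PO ∧ S.IsOptimalStable c β γ (O π) π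

/-! An event `E : Δ(Y) → {0, 1}` is given by the set of forecasts on which it takes the value 1. -/

section Events

variable [Fintype A]

open Classical in
/-- The events `(p_t, r_t) = (p, r)`, for `p ∈ PO` and `r ∈ A`. -/
def Selection.events1 (S : Selection G ε) (PO : Finset P) (O : Belief Y → P) :
    Finset (Set (Belief Y)) :=
  (PO ×ˢ (Finset.univ : Finset A)).image fun x => {π | O π = x.1 ∧ S.astar (O π) π = x.2}

open Classical in
/-- The events "the optimistic policy and action are `(p, a)`", for `p ∈ P₀` and `a ∈ A`. -/
def Selection.events2 (S : Selection G ε) : Finset (Set (Belief Y)) :=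
  (G.benchmark ×ˢ (Finset.univ : Finset A)).image
    fun x => {π | S.popt π = x.1 ∧ S.aopt (S.popt π) π = x.2}

open Classical in
/-- The events `a*(p₀, π_t) = a`, for a given policy `p₀` and `a ∈ A`. -/
def Selection.events3At (S : Selection G ε) (p₀ : P) : Finset (Set (Belief Y)) :=
  (Finset.univ : Finset A).image fun a => {π | S.astar p₀ π = a}

open Classical in
/-- The events `a*(p₀, π_t) = a`, for `p₀ ∈ P₀` and `a ∈ A`. -/
def Selection.events3 (S : Selection G ε) : Finset (Set (Belief Y)) :=
  G.benchmark.biUnion fun p₀ => S.events3At p₀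

open Classical in
/-- The collection of all events for which the forecasts have to be unbiased. -/
def Selection.events (S : Selection G ε) (PO : Finset P) (O : Belief Y → P) :
    Finset (Set (Belief Y)) :=
  S.events1 PO O ∪ S.events2 ∪ S.events3

end Events

end Stage

section Forecasts

variable {Y : Type*} [Fintype Y]

open Classical in
/-- The bias of the forecasts conditional on the event `E`,
`(1 / T) ‖∑ₜ E(π_t) (π_t - y_t)‖₁`, with states in one-hot encoding. -/
def bias {T : ℕ} (E : Set (Belief Y)) (π : Fin T → Belief Y) (y : Fin T → Y) : ℝ :=
  1 / (T : ℝ) *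
    ∑ i : Y, |∑ t : Fin T, if π t ∈ E then (π t).1 i - (if y t = i then 1 else 0) else 0|

/-- The forecasts have bias `α` conditional on the collection of events `𝓔`. -/
def HasConditionalBias {T : ℕ} (𝓔 : Finset (Set (Belief Y))) (α : Set (Belief Y) → ℝ)
    (π : Fin T → Belief Y) (y : Fin T → Y) : Prop :=
  ∀ E ∈ 𝓔, bias E π y ≤ α E

open Classical in
/-- The number of rounds `t` with `E(π_t) = 1`. -/
def hits {T : ℕ} (E : Set (Belief Y)) (π : Fin T → Belief Y) : ℕ :=
  (Finset.univ.filter fun t => π t ∈ E).card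

/-- A randomized forecasting algorithm: in each round it maps the past states and its own past
forecasts to a distribution of the next forecast. -/
abbrev Forecaster (Y : Type*) [Fintype Y] :=
  (n : ℕ) → (Fin n → Y) → (Fin n → Belief Y) → PMF (Belief Y)

/-- The distribution of the forecasts `π_{1:n}` when the states are `y_{1:n}`. -/
def forecastLaw (F : Forecaster Y) : (n : ℕ) → (Fin n → Y) → PMF (Fin n → Belief Y)
  | 0, _ => PMF.pure Fin.elim0
  | n + 1, y => (forecastLaw F n (Fin.init y)).bind fun π =>
      (F n (Fin.init y) π).map fun q => (Fin.snoc π q : Fin (n + 1) → Belief Y)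

/-- The conditional bias guarantee of the forecasting algorithm over `T` rounds, for the events
`𝓔` and with constant `κ`: for every sequence of states, the bias conditional on `E` is at most
`κ |Y| √(ln(|Y| |𝓔| T) |{t : E(π_t) = 1}|) / T`, up to an excess whose maximum over all `E ∈ 𝓔` is
in expectation at most `κ |Y| ln(|Y| |𝓔| T) / T`. -/
def HasBiasGuarantee (κ : ℝ) (F : Forecaster Y) (𝓔 : Finset (Set (Belief Y))) (T : ℕ) : Prop :=
  ∀ y : Fin T → Y,
    expect (forecastLaw F T y) (fun π => ⨆ E : {E // E ∈ 𝓔},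
      (bias E.1 π y - κ * (Fintype.card Y : ℝ) *
        √(Real.log ((Fintype.card Y : ℝ) * (𝓔.card : ℝ) * (T : ℝ)) * (hits E.1 π : ℝ)) / (T : ℝ)))
      ≤ κ * (Fintype.card Y : ℝ) *
          Real.log ((Fintype.card Y : ℝ) * (𝓔.card : ℝ) * (T : ℝ)) / (T : ℝ)

end Forecasts

section Interaction

variable {P A Y : Type*}

/-- A learning algorithm of the Agent: the states and actions of the past rounds and the
recommendations and policies up to the current round are mapped to a distribution over actions. -/
abbrev AgentAlgorithm (P A Y : Type*) :=
  (n : ℕ) → (Fin n → Y) → (Fin n → A) → (Fin (n + 1) → A) → (Fin (n + 1) → P) → PMF A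

/-- The distribution of the actions `a_{1:n}` of the Agent, for the states `y_{1:n}`, policies
`p_{1:n}` and recommendations `r_{1:n}`. -/
def actionLaw (L : AgentAlgorithm P A Y) :
    (n : ℕ) → (Fin n → Y) → (Fin n → P) → (Fin n → A) → PMF (Fin n → A)
  | 0, _, _, _ => PMF.pure Fin.elim0
  | n + 1, y, p, r =>
      (actionLaw L n (Fin.init y) (Fin.init p) (Fin.init r)).bind fun a =>
        (L n (Fin.init y) a r p).map fun b => (Fin.snoc a b : Fin (n + 1) → A)

/-- The contextual swap regret `SwapReg(y_{1:T}, p_{1:T}, r_{1:T})` of the Agent. -/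
def swapRegret (G : Game P A Y) (L : AgentAlgorithm P A Y) {T : ℕ}
    (y : Fin T → Y) (p : Fin T → P) (r : Fin T → A) : ℝ :=
  expect (actionLaw L T y p r) fun a =>
    ⨆ h : P → A → A → A,
      1 / (T : ℝ) * ∑ t, (G.U (h (p t) (r t) (a t)) (p t) (y t) - G.U (a t) (p t) (y t))

open Classical in
/-- The rounds in which policy `q` and recommendation `s` are used. -/
def rounds {T : ℕ} (p : Fin T → P) (r : Fin T → A) (q : P) (s : A) : Finset (Fin T) :=
  Finset.univ.filter fun t => p t = q ∧ r t = s

open Classical in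
/-- The empirical distribution of the actions in the rounds `I`. -/
def empirical {T : ℕ} (I : Finset (Fin T)) (a : Fin T → A) (b : A) : ℝ :=
  ((I.filter fun t => a t = b).card : ℝ) / (I.card : ℝ)

/-- The Agent has no secret information with respect to the utility function `W`, with constant
`K`, for given sequences of states, policies and recommendations. -/
def NoSecretInfoFor [Fintype A] (W : A → P → Y → ℝ) (K : ℝ) (L : AgentAlgorithm P A Y) {T : ℕ}
    (y : Fin T → Y) (p : Fin T → P) (r : Fin T → A) : Prop :=
  ∀ (q : P) (s : A),
    1 / ((rounds p r q s).card : ℝ) *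
      expect (actionLaw L T y p r) (fun a =>
        |∑ t ∈ rounds p r q s,
          (W (a t) q (y t) - ∑ b, empirical (rounds p r q s) a b * W b q (y t))|)
      ≤ K / √((rounds p r q s).card : ℝ)

section Mechanism

variable [Fintype Y] {G : Game P A Y} {ε : ℝ}

/-- The recommendations `r_t = a*(p_t, π_t)`. -/
def Selection.recommend (S : Selection G ε) {T : ℕ} (p : Fin T → P) (π : Fin T → Belief Y) :
    Fin T → A := fun t => S.astar (p t) (π t)

/-- For the forecasts `π`, the Agent has contextual swap regret at most `εswap` both under the
choice rule `ψ` and under every constant benchmark policy. -/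
def Selection.NoSwapRegret (S : Selection G ε) (ψ : Belief Y → P) (L : AgentAlgorithm P A Y)
    (εswap : ℝ) {T : ℕ} (y : Fin T → Y) (π : Fin T → Belief Y) : Prop :=
  swapRegret G L y (fun t => ψ (π t)) (S.recommend (fun t => ψ (π t)) π) ≤ εswap ∧
    ∀ p₀ ∈ G.benchmark, swapRegret G L y (fun _ => p₀) (S.recommend (fun _ => p₀) π) ≤ εswap

/-- For the forecasts `π`, the Agent has no secret information (with constant `K`) both under the
choice rule `ψ` and under every constant benchmark policy. -/
def Selection.NoSecretInfo [Fintype A] (S : Selection G ε) (ψ : Belief Y → P)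
    (L : AgentAlgorithm P A Y) (K : ℝ) {T : ℕ} (y : Fin T → Y) (π : Fin T → Belief Y) : Prop :=
  (NoSecretInfoFor G.U K L y (fun t => ψ (π t)) (S.recommend (fun t => ψ (π t)) π) ∧
    NoSecretInfoFor G.V K L y (fun t => ψ (π t)) (S.recommend (fun t => ψ (π t)) π)) ∧
  ∀ p₀ ∈ G.benchmark,
    NoSecretInfoFor G.U K L y (fun _ => p₀) (S.recommend (fun _ => p₀) π) ∧
    NoSecretInfoFor G.V K L y (fun _ => p₀) (S.recommend (fun _ => p₀) π)

/-- The expected average utility of the Principal when she uses the policies `p` and the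
recommendations that belong to the forecasts `π`. -/
def Selection.payoff (S : Selection G ε) (L : AgentAlgorithm P A Y) {T : ℕ} (y : Fin T → Y)
    (p : Fin T → P) (π : Fin T → Belief Y) : ℝ :=
  expect (actionLaw L T y p (S.recommend p π)) fun a => 1 / (T : ℝ) * ∑ t, G.V (a t) (p t) (y t)

/-- The policy regret `PR(ψ, π_{1:T}, L, y_{1:T})` for given forecasts. -/
def Selection.regretGiven (S : Selection G ε) (ψ : Belief Y → P) (L : AgentAlgorithm P A Y)
    {T : ℕ} (y : Fin T → Y) (π : Fin T → Belief Y) : ℝ :=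
  G.benchmark.sup' G.benchmark_nonempty fun p₀ =>
    S.payoff L y (fun _ => p₀) π - S.payoff L y (fun t => ψ (π t)) π

/-- The policy regret `PR(σ, L, y_{1:T})` of the mechanism `σ = (F, ψ)`. -/
def Selection.regret (S : Selection G ε) (F : Forecaster Y) (ψ : Belief Y → P)
    (L : AgentAlgorithm P A Y) {T : ℕ} (y : Fin T → Y) : ℝ :=
  expect (forecastLaw F T y) fun π => S.regretGiven ψ L y π

end Mechanism

end Interaction

end PrincipalAgent

end

/-! The argument has two halves: a transfer inequality from forecasts to realized payoffs, and a
forecaster that is nearly unbiased on the events.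

Transfer. Suppose that in each round every action `b` satisfies `v_t ≤ W(b, p_t, π_t) + λ ·
(forecast regret of b against r_t)`. Fix a cell, that is, the rounds with a given policy and
recommendation. For fixed `b`, summing over the cell and replacing forecasts by states costs only
the bias on the cell. Averaging over `b` with the empirical action frequencies, and then returning
from frequencies to actual actions, costs what the no-secret-information assumption allows. The
remaining regret is that of always switching to the recommendation, which the contextual swap regret
controls. This is `sum_realized_ge`; `average_le_expect_of_le` sums it over cells, using
Cauchy–Schwarz for the terms of order `√n`.

It is applied twice. Under the oracle, `W = V` and `λ = 2/β`: by stability an action loses at most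
`γ` or has forecast regret at least `β`, and then the penalty 2 covers the whole range of `V`. Under
a benchmark policy, `W = -V` and `λ = 2/ε`: an action outside the `ε`-best responses is penalized by
at least 2, and any other is dominated by `aopt`. Optimality of the oracle compares the two forecast
values round by round at cost `c`, so the events of the optimistic policy contribute only
nonnegative slack.

Forecaster. Each event, state, sign and learning rate gives a test, and the potential is a sum of
exponentials of compensated test scores. Against `y ∼ q` the forecast `q` makes every test fair; a
separation argument (`exists_randomized_belief`) turns this into a randomized forecast with almost
no drift against every state. A small potential bounds all biases at once, with the rate tuned to
the realized number of hits.

For the random forecasts the regret bound is affine in the single quantity `biasExcess`, so the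
expectation passes through. This handles `|PO||A| ≤ T`; otherwise the bound is trivial. -/

noncomputable section

namespace PrincipalAgent

/-! ### Expectations of bounded functions under discrete distributions -/

section Expect

variable {Ω Ω' : Type*}

theorem summable_toReal_coe (μ : PMF Ω) : Summable fun x => (μ x).toReal :=
  ENNReal.summable_toReal (by rw [μ.tsum_coe]; exact ENNReal.one_ne_top)

theorem tsum_toReal_coe (μ : PMF Ω) : ∑' x, (μ x).toReal = 1 := by
  rw [← ENNReal.tsum_toReal_eq fun x => μ.apply_ne_top x, μ.tsum_coe, ENNReal.toReal_one]

theorem summable_expect (μ : PMF Ω) {f : Ω → ℝ} (hf : ∃ M, ∀ x, |f x| ≤ M) :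
    Summable fun x => (μ x).toReal * f x := by
  obtain ⟨M, hM⟩ := hf
  refine Summable.of_norm_bounded ((summable_toReal_coe μ).mul_right M) fun x => ?_
  rw [Real.norm_eq_abs, abs_mul, abs_of_nonneg ENNReal.toReal_nonneg]
  exact mul_le_mul_of_nonneg_left (hM x) ENNReal.toReal_nonneg

theorem bounded_of_finite [Finite Ω] (f : Ω → ℝ) : ∃ M, ∀ x, |f x| ≤ M := by
  obtain ⟨M, hM⟩ := (Set.finite_range fun x => |f x|).bddAbove
  exact ⟨M, fun x => hM ⟨x, rfl⟩⟩

@[simp] theorem expect_const (μ : PMF Ω) (c : ℝ) : expect μ (fun _ => c) = c := by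
  rw [expect, tsum_mul_right, tsum_toReal_coe, one_mul]

theorem expect_add (μ : PMF Ω) {f g : Ω → ℝ} (hf : ∃ M, ∀ x, |f x| ≤ M)
    (hg : ∃ M, ∀ x, |g x| ≤ M) :
    expect μ (fun x => f x + g x) = expect μ f + expect μ g := by
  simp only [expect, mul_add]
  exact (summable_expect μ hf).tsum_add (summable_expect μ hg)

theorem expect_const_mul (μ : PMF Ω) (c : ℝ) (f : Ω → ℝ) :
    expect μ (fun x => c * f x) = c * expect μ f := by
  simp only [expect, mul_left_comm _ c]
  exact tsum_mul_left

theorem expect_neg (μ : PMF Ω) (f : Ω → ℝ) : expect μ (fun x => -f x) = -expect μ f := by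
  simpa using expect_const_mul μ (-1) f

/-- Points of probability zero are ignored because the behavioral assumptions are available only for
forecasts in the support. -/
theorem expect_mono_of_support (μ : PMF Ω) {f g : Ω → ℝ} (hf : ∃ M, ∀ x, |f x| ≤ M)
    (hg : ∃ M, ∀ x, |g x| ≤ M) (h : ∀ x ∈ μ.support, f x ≤ g x) : expect μ f ≤ expect μ g := by
  refine (summable_expect μ hf).tsum_le_tsum (fun x => ?_) (summable_expect μ hg)
  by_cases hx : x ∈ μ.support
  · exact mul_le_mul_of_nonneg_left (h x hx) ENNReal.toReal_nonneg
  · simp [(μ.apply_eq_zero_iff x).2 hx]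

theorem expect_mono (μ : PMF Ω) {f g : Ω → ℝ} (hf : ∃ M, ∀ x, |f x| ≤ M)
    (hg : ∃ M, ∀ x, |g x| ≤ M) (h : ∀ x, f x ≤ g x) : expect μ f ≤ expect μ g :=
  expect_mono_of_support μ hf hg fun x _ => h x

theorem expect_sum [Finite Ω] (μ : PMF Ω) {ι : Type*} (s : Finset ι) (f : ι → Ω → ℝ) :
    expect μ (fun x => ∑ i ∈ s, f i x) = ∑ i ∈ s, expect μ (f i) := by
  simp only [expect, Finset.mul_sum]
  exact Summable.tsum_finsetSum fun i _ => summable_expect μ (bounded_of_finite _)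

theorem expect_eq_toReal (μ : PMF Ω) {f : Ω → ℝ} (hf : ∀ x, 0 ≤ f x) :
    expect μ f = (∑' x, μ x * ENNReal.ofReal (f x)).toReal := by
  rw [ENNReal.tsum_toReal_eq fun x => ENNReal.mul_ne_top (μ.apply_ne_top x) ENNReal.ofReal_ne_top]
  simp [expect, ENNReal.toReal_mul, ENNReal.toReal_ofReal (hf _)]

/-- For nonnegative functions this is Tonelli in `ENNReal`; a bounded `f` is reduced to that case by
adding the bound `M`. -/
theorem expect_bind (μ : PMF Ω) (ν : Ω → PMF Ω') {f : Ω' → ℝ} (hf : ∃ M, ∀ x, |f x| ≤ M) :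
    expect (μ.bind ν) f = expect μ fun z => expect (ν z) f := by
  obtain ⟨M, hM⟩ := hf
  have key : ∀ g : Ω' → ℝ, (∀ x, 0 ≤ g x) → (∃ M, ∀ x, |g x| ≤ M) →
      expect (μ.bind ν) g = expect μ fun z => expect (ν z) g := by
    intro g hg ⟨M, hM⟩
    have hfin : ∀ z, ∑' x, ν z x * ENNReal.ofReal (g x) ≠ ⊤ := by
      intro z
      refine ne_top_of_le_ne_top (b := ∑' x, ν z x * ENNReal.ofReal M) ?_
        (ENNReal.tsum_le_tsum fun x => ?_)
      · rw [ENNReal.tsum_mul_right, (ν z).tsum_coe, one_mul]; exact ENNReal.ofReal_ne_top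
      · gcongr; exact (le_abs_self _).trans (hM x)
    have hnn : ∀ z, 0 ≤ expect (ν z) g := fun z =>
      tsum_nonneg fun x => mul_nonneg ENNReal.toReal_nonneg (hg x)
    rw [expect_eq_toReal _ hg, expect_eq_toReal _ hnn]
    congr 1
    simp_rw [fun z => expect_eq_toReal (ν z) hg, ENNReal.ofReal_toReal (hfin _), PMF.bind_apply,
      ← ENNReal.tsum_mul_right, ← ENNReal.tsum_mul_left]
    rw [ENNReal.tsum_comm]
    simp_rw [mul_assoc]
  have hb : ∃ M', ∀ x, |f x + M| ≤ M' :=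
    ⟨M + M, fun x => (abs_add_le _ _).trans
      (add_le_add (hM x) (abs_of_nonneg ((abs_nonneg _).trans (hM x))).le)⟩
  have h := key (fun x => f x + M) (fun x => by linarith [neg_abs_le (f x), hM x]) hb
  have hin : ∃ M', ∀ z, |expect (ν z) f| ≤ M' := by
    refine ⟨M, fun z => abs_le.2 ⟨?_, ?_⟩⟩
    · simpa using expect_mono (ν z) (f := fun _ => -M) ⟨|-M|, fun _ => le_rfl⟩ ⟨M, hM⟩
        fun x => (abs_le.1 (hM x)).1
    · simpa using expect_mono (ν z) (g := fun _ => M) ⟨M, hM⟩ ⟨|M|, fun _ => le_rfl⟩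
        fun x => (abs_le.1 (hM x)).2
  have h2 : (fun z => expect (ν z) fun x => f x + M) = fun z => expect (ν z) f + M := by
    funext z; rw [expect_add _ ⟨M, hM⟩ ⟨|M|, fun _ => le_rfl⟩, expect_const]
  rw [h2, expect_add _ ⟨M, hM⟩ ⟨|M|, fun _ => le_rfl⟩, expect_add _ hin ⟨|M|, fun _ => le_rfl⟩, expect_const, expect_const] at h
  linarith

theorem expect_pure (a : Ω) (f : Ω → ℝ) : expect (PMF.pure a) f = f a := by
  classical
  rw [expect, tsum_eq_single a]
  · simp
  · intro b hb; simp [hb]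

theorem expect_map (μ : PMF Ω) (g : Ω → Ω') {f : Ω' → ℝ} (hf : ∃ M, ∀ x, |f x| ≤ M) :
    expect (μ.map g) f = expect μ fun x => f (g x) := by
  rw [← PMF.bind_pure_comp, expect_bind _ _ hf]
  simp [expect_pure]

end Expect

/-! ### A minimax lemma for randomized forecasts -/

section Minimax

variable {Y : Type*} [Fintype Y]

/-- If each belief `q` makes the expected loss nonpositive under `y ∼ q`, then some randomization
over beliefs has expected loss at most `δ` against every state. -/
theorem exists_randomized_belief [Nonempty Y] {g : Belief Y → Y → ℝ}
    (hb : ∀ y, ∃ M, ∀ q, |g q y| ≤ M)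
    (hg : ∀ q : Belief Y, ∑ y, q.1 y * g q y ≤ 0) {δ : ℝ} (hδ : 0 < δ) :
    ∃ ν : PMF (Belief Y), ∀ y, expect ν (fun q => g q y) ≤ δ := by
  classical
  -- The loss vectors of mixtures form the convex hull of the range of `g`. No continuity in `q` is
  -- available, since events are arbitrary sets, so the hull need not be closed; the margin `δ`
  -- gives an open orthant to separate from it.
  have hne : ¬ Disjoint (Set.univ.pi fun _ : Y => Set.Iio δ) (convexHull ℝ (Set.range g)) := by
    intro hdis
    obtain ⟨f, u, hf1, hf2⟩ := geometric_hahn_banach_open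
      (convex_pi fun _ _ => convex_Iio δ) (isOpen_set_pi Set.finite_univ fun _ _ => isOpen_Iio)
      (convex_convexHull ℝ _) hdis
    set e : Y → ℝ := fun y => f (Pi.single y 1) with he
    have hfe : ∀ v : Y → ℝ, f v = ∑ y, v y * e y := by
      intro v
      conv_lhs => rw [← Finset.univ_sum_single v]
      rw [map_sum]
      refine Finset.sum_congr rfl fun y _ => ?_
      rw [← mul_one (v y), ← smul_eq_mul, Pi.single_smul, map_smul]
      simp [he]
    -- The orthant is unbounded below in each coordinate, so a negative coefficient would make `f`
    -- exceed `u` there.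
    have he0 : ∀ y, 0 ≤ e y := by
      intro y
      by_contra! hy
      obtain ⟨N, hN⟩ := exists_nat_gt (u / (-e y))
      rw [div_lt_iff₀ (by linarith)] at hN
      have := hf1 (Pi.single y (-N)) fun z _ => by
        rw [Set.mem_Iio]
        by_cases hz : z = y
        · subst hz; simp; linarith [(Nat.cast_nonneg N : (0 : ℝ) ≤ N)]
        · simp [hz, hδ]
      rw [hfe, Finset.sum_eq_single y (by intro b _ hb; simp [hb]) (by simp)] at this
      simp at this
      linarith
    obtain ⟨q0⟩ : Nonempty (Belief Y) :=
      ⟨⟨Pi.single (Classical.arbitrary Y) 1, single_mem_stdSimplex ℝ _⟩⟩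
    have hs : 0 < ∑ y, e y := by
      refine lt_of_le_of_ne (Finset.sum_nonneg fun y _ => he0 y) fun h => ?_
      have hz : ∀ y, e y = 0 := fun y =>
        (Finset.sum_eq_zero_iff_of_nonneg fun y _ => he0 y).1 h.symm y (Finset.mem_univ y)
      have h1 := hf1 0 fun z _ => by simpa using hδ
      have h2 := hf2 _ (subset_convexHull ℝ _ ⟨q0, rfl⟩)
      simp [hfe, hz] at h1 h2
      linarith
    -- The normalized separating functional is itself a belief. Its own loss vector has `f`-value at
    -- most 0, whereas `f` is positive at the constant vector `δ / 2` of the orthant.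
    set q : Belief Y := ⟨fun y => e y / ∑ z, e z,
      fun y => div_nonneg (he0 y) hs.le, by rw [← Finset.sum_div, div_self hs.ne']⟩ with hq
    have h2 := hf2 _ (subset_convexHull ℝ _ ⟨q, rfl⟩)
    have h1 := hf1 (fun _ => δ / 2) fun z _ => by simp; linarith
    rw [hfe, ← Finset.mul_sum] at h1
    have h3 : f (g q) = (∑ z, e z) * ∑ y, q.1 y * g q y := by
      rw [hfe, Finset.mul_sum]
      refine Finset.sum_congr rfl fun y _ => ?_
      simp only [hq]
      field_simp
    have h4 := mul_nonpos_of_nonneg_of_nonpos hs.le (hg q)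
    have h5 := mul_pos (half_pos hδ) hs
    linarith
  obtain ⟨v, hv, hvc⟩ := Set.not_disjoint_iff.1 hne
  obtain ⟨ι, _, w, z, hw0, hw1, hz, hzv⟩ := mem_convexHull_iff_exists_fintype.1 hvc
  choose b hb' using hz
  have hsum : ∑ i, ENNReal.ofReal (w i) = 1 := by
    rw [← ENNReal.ofReal_sum_of_nonneg fun i _ => hw0 i, hw1, ENNReal.ofReal_one]
  refine ⟨(PMF.ofFintype _ hsum).map b, fun y => ?_⟩
  rw [expect_map _ _ (hb y), expect, tsum_fintype]
  have : ∑ i, (PMF.ofFintype _ hsum i).toReal * g (b i) y = v y := by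
    rw [← hzv, Finset.sum_apply]
    refine Finset.sum_congr rfl fun i _ => ?_
    rw [PMF.ofFintype_apply, ENNReal.toReal_ofReal (hw0 i), hb', Pi.smul_apply, smul_eq_mul]
  rw [this]
  exact (hv y (Set.mem_univ y)).le

end Minimax

/-! ### The exponential potential and its forecaster -/

section Potential

variable {Y : Type*} [Fintype Y]

open Classical in
/-- The deviation of the forecast probability of the state `i` from its realization. -/
def residual (q : Belief Y) (y i : Y) : ℝ := q.1 i - if y = i then 1 else 0

theorem abs_residual_le (q : Belief Y) (y i : Y) : |residual q y i| ≤ 1 := by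
  have h0 := q.2.1 i
  have h1 : q.1 i ≤ 1 := (mem_Icc_of_mem_stdSimplex q.2 i).2
  unfold residual
  split_ifs <;> rw [abs_le] <;> constructor <;> linarith

theorem abs_mul_residual_le (c : ℝ) (q : Belief Y) (y i : Y) : |c * residual q y i| ≤ |c| := by
  rw [abs_mul]
  exact mul_le_of_le_one_right (abs_nonneg _) (abs_residual_le _ _ _)

theorem sum_mul_residual (q : Belief Y) (i : Y) : ∑ y, q.1 y * residual q y i = 0 := by
  classical
  have h := q.2.2
  simp only [residual, mul_sub, Finset.sum_sub_distrib, ← Finset.sum_mul, h]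
  simp

/-- The compensator `u ^ 2` absorbs the curvature of the exponential, leaving only a linear
increment. For `u ≥ 0` it follows from `log (1 + u) ≥ u / (1 + u)`, for `u ≤ 0` from the quadratic
lower bound on `exp (u ^ 2 - u)`. -/
theorem exp_sub_sq_le {u : ℝ} (hu : |u| ≤ 1 / 2) : Real.exp (u - u ^ 2) ≤ 1 + u := by
  have h := abs_le.1 hu
  have h1 : 0 < 1 + u := by linarith
  rcases le_total 0 u with h0 | h0
  · have h2 : u - u ^ 2 ≤ 1 - (1 + u)⁻¹ := by
      rw [le_sub_iff_add_le, ← le_sub_iff_add_le', inv_le_iff_one_le_mul₀ h1]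
      nlinarith [pow_nonneg h0 3]
    rw [← Real.le_log_iff_exp_le h1]
    exact h2.trans (Real.one_sub_inv_le_log_of_pos h1)
  · have h2 := Real.quadratic_le_exp_of_nonneg (x := u ^ 2 - u) (by nlinarith)
    have h3 : 1 ≤ (1 + u) * Real.exp (u ^ 2 - u) := by
      refine le_trans ?_ (mul_le_mul_of_nonneg_left h2 h1.le)
      have h4 : 0 ≤ 1 + u - u ^ 2 + u ^ 3 := by nlinarith [sq_nonneg u]
      nlinarith [mul_nonneg (sq_nonneg u) h4]
    rw [← neg_sub, Real.exp_neg, inv_le_iff_one_le_mul₀ (Real.exp_pos _)]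
    exact h3

variable {ι : Type*} [Fintype ι]

/-- The exponential potential of the tests `f`, where `f x` tests the residual of the state `j x`. -/
def potential (f : ι → Belief Y → ℝ) (j : ι → Y) {n : ℕ} (π : Fin n → Belief Y) (y : Fin n → Y) :
    ℝ :=
  ∑ x, Real.exp (∑ t, (f x (π t) * residual (π t) (y t) (j x) - f x (π t) ^ 2))

theorem potential_nonneg (f : ι → Belief Y → ℝ) (j : ι → Y) {n : ℕ} (π : Fin n → Belief Y)
    (y : Fin n → Y) : 0 ≤ potential f j π y :=
  Finset.sum_nonneg fun _ _ => (Real.exp_pos _).le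

variable {f : ι → Belief Y → ℝ} {j : ι → Y}

theorem potential_le (hf : ∀ x q, |f x q| ≤ 1 / 2) {n : ℕ} (π : Fin n → Belief Y)
    (y : Fin n → Y) : potential f j π y ≤ Fintype.card ι * Real.exp n := by
  have : ∀ x, Real.exp (∑ t, (f x (π t) * residual (π t) (y t) (j x) - f x (π t) ^ 2))
      ≤ Real.exp n := by
    intro x
    rw [Real.exp_le_exp]
    calc ∑ t, (f x (π t) * residual (π t) (y t) (j x) - f x (π t) ^ 2) ≤ ∑ _t : Fin n, (1 : ℝ) := by
          refine Finset.sum_le_sum fun t _ => ?_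
          have := (le_abs_self _).trans (abs_mul_residual_le (f x (π t)) (π t) (y t) (j x))
          linarith [hf x (π t), sq_nonneg (f x (π t))]
      _ = n := by simp
  simpa [potential] using Finset.sum_le_sum fun x (_ : x ∈ Finset.univ) => this x

/-- The growth is linear in the new residual, so its mean vanishes when the state is drawn from the
forecast. Compensating by `f ^ 2` instead of `(f * residual) ^ 2` is weaker, as `|residual| ≤ 1`,
but makes the total compensator depend on the hits only. -/
theorem potential_snoc_le (hf : ∀ x q, |f x q| ≤ 1 / 2) {n : ℕ} (π : Fin n → Belief Y)
    (q : Belief Y) (y : Fin (n + 1) → Y) :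
    potential f j (Fin.snoc π q : Fin (n + 1) → Belief Y) y ≤
      potential f j π (Fin.init y) +
        ∑ x, Real.exp (∑ t, (f x (π t) * residual (π t) (Fin.init y t) (j x) - f x (π t) ^ 2)) *
          (f x q * residual q (y (Fin.last n)) (j x)) := by
  rw [potential, potential, ← Finset.sum_add_distrib]
  refine Finset.sum_le_sum fun x _ => ?_
  rw [Fin.sum_univ_castSucc, Real.exp_add]
  simp only [Fin.snoc_castSucc, Fin.snoc_last, Fin.init]
  have h := abs_mul_residual_le (f x q) q (y (Fin.last n)) (j x)
  have h1 := exp_sub_sq_le (h.trans (hf x q))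
  have h2 : Real.exp (f x q * residual q (y (Fin.last n)) (j x) - f x q ^ 2) ≤
      1 + f x q * residual q (y (Fin.last n)) (j x) :=
    (Real.exp_le_exp.2 (by linarith [sq_le_sq.2 h])).trans h1
  calc _ ≤ _ := mul_le_mul_of_nonneg_left h2 (Real.exp_pos _).le
    _ = _ := by ring

/-- Some forecaster keeps the expected potential below its initial value plus `δ` per round. -/
theorem exists_forecaster_potential_le [Nonempty Y] (f : ι → Belief Y → ℝ) (j : ι → Y)
    (hf : ∀ x q, |f x q| ≤ 1 / 2) {δ : ℝ} (hδ : 0 < δ) :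
    ∃ F : Forecaster Y, ∀ (n : ℕ) (y : Fin n → Y),
      expect (forecastLaw F n y) (fun π => potential f j π y) ≤ Fintype.card ι + n * δ := by
  have hb : ∀ (w : ι → ℝ) (y : Y), ∃ M, ∀ q, |∑ x, w x * (f x q * residual q y (j x))| ≤ M := by
    intro w y
    refine ⟨∑ x, |w x|, fun q => (Finset.abs_sum_le_sum_abs _ _).trans
      (Finset.sum_le_sum fun x _ => ?_)⟩
    rw [abs_mul]
    refine mul_le_of_le_one_right (abs_nonneg _) ?_
    linarith [abs_mul_residual_le (f x q) q y (j x), hf x q]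
  have step : ∀ w : ι → ℝ, ∃ ν : PMF (Belief Y), ∀ y,
      expect ν (fun q => ∑ x, w x * (f x q * residual q y (j x))) ≤ δ := by
    -- With `y ∼ q` the expected increment is exactly zero, whatever the weights `w`; the current
    -- exponentials will be used as weights.
    refine fun w => exists_randomized_belief (hb w) (fun q => le_of_eq ?_) hδ
    simp_rw [Finset.mul_sum]
    rw [Finset.sum_comm]
    refine Finset.sum_eq_zero fun x _ => ?_
    calc _ = w x * f x q * ∑ y, q.1 y * residual q y (j x) := by
          rw [Finset.mul_sum]; exact Finset.sum_congr rfl fun y _ => by ring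
      _ = 0 := by rw [sum_mul_residual, mul_zero]
  choose ν hν using step
  have hbp : ∀ {n : ℕ} (y : Fin n → Y), ∃ M, ∀ π : Fin n → Belief Y, |potential f j π y| ≤ M :=
    fun {n} y => ⟨Fintype.card ι * Real.exp n, fun π => by
      rw [abs_of_nonneg (potential_nonneg f j π y)]; exact potential_le hf π y⟩
  refine ⟨fun n y π => ν fun x =>
    Real.exp (∑ t, (f x (π t) * residual (π t) (y t) (j x) - f x (π t) ^ 2)), fun n => ?_⟩
  induction n with
  | zero => intro y; simp [forecastLaw, potential]
  | succ n ih =>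
    intro y
    rw [forecastLaw, expect_bind _ _ (hbp y)]
    simp_rw [expect_map _ _ (hbp y)]
    calc _ ≤ expect (forecastLaw _ n (Fin.init y)) fun π => potential f j π (Fin.init y) + δ := by
          obtain ⟨M, hM⟩ := hbp y
          obtain ⟨M', hM'⟩ := hbp (Fin.init y)
          refine expect_mono _ ⟨M, fun π => ?_⟩ ⟨M' + |δ|, fun π => ?_⟩ fun π => ?_
          · rw [abs_le]
            constructor
            · simpa using expect_mono _ (f := fun _ => -M) ⟨|-M|, fun _ => le_rfl⟩
                ⟨M, fun q => hM _⟩ fun q => (abs_le.1 (hM _)).1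
            · simpa using expect_mono _ (g := fun _ => M) ⟨M, fun q => hM _⟩
                ⟨|M|, fun _ => le_rfl⟩ fun q => (abs_le.1 (hM _)).2
          · exact (abs_add_le _ _).trans (add_le_add (hM' π) le_rfl)
          · refine (expect_mono _ ⟨M, fun q => hM _⟩ ?_
              fun q => potential_snoc_le hf π q y).trans ?_
            · obtain ⟨B, hB⟩ := hb (fun x => Real.exp (∑ t, (f x (π t) *
                residual (π t) (Fin.init y t) (j x) - f x (π t) ^ 2))) (y (Fin.last n))
              exact ⟨M' + B, fun q => (abs_add_le _ _).trans (add_le_add (hM' π) (hB q))⟩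
            · rw [expect_add _ ⟨_, fun _ => le_rfl⟩ (hb _ _), expect_const]
              gcongr
              exact hν _ _
      _ = expect (forecastLaw _ n (Fin.init y)) (fun π => potential f j π (Fin.init y)) + δ := by
          rw [expect_add _ (hbp _) ⟨_, fun _ => le_rfl⟩, expect_const]
      _ ≤ _ := by
          push_cast
          linarith [ih (Fin.init y)]

end Potential

/-! ### From the potential to the conditional bias guarantee -/

section Bias

variable {Y : Type*} [Fintype Y] {T : ℕ}

open Classical in
/-- The cumulative residual of the state `i` in the rounds of the event `E`. -/
def deviation (E : Set (Belief Y)) (π : Fin T → Belief Y) (y : Fin T → Y) (i : Y) : ℝ :=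
  ∑ t, if π t ∈ E then residual (π t) (y t) i else 0

theorem bias_eq (E : Set (Belief Y)) (π : Fin T → Belief Y) (y : Fin T → Y) :
    bias E π y = 1 / (T : ℝ) * ∑ i, |deviation E π y i| := rfl

theorem bias_nonneg (E : Set (Belief Y)) (π : Fin T → Belief Y) (y : Fin T → Y) :
    0 ≤ bias E π y :=
  mul_nonneg (by positivity) (Finset.sum_nonneg fun _ _ => abs_nonneg _)

theorem mul_bias (hT : 0 < T) (E : Set (Belief Y)) (π : Fin T → Belief Y) (y : Fin T → Y) :
    T * bias E π y = ∑ i, |deviation E π y i| := by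
  have : (T : ℝ) ≠ 0 := by positivity
  rw [bias_eq]; field_simp

theorem sum_abs_residual_le (q : Belief Y) (y : Y) : ∑ i, |residual q y i| ≤ 2 := by
  classical
  calc ∑ i, |residual q y i| ≤ ∑ i, (q.1 i + if y = i then 1 else 0) := by
        refine Finset.sum_le_sum fun i _ => ?_
        have := q.2.1 i
        unfold residual
        split_ifs <;> rw [abs_le] <;> constructor <;> linarith
    _ = 2 := by
        rw [Finset.sum_add_distrib, q.2.2, Finset.sum_ite_eq]
        norm_num

theorem bias_le_two (hT : 0 < T) (E : Set (Belief Y)) (π : Fin T → Belief Y) (y : Fin T → Y) :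
    bias E π y ≤ 2 := by
  classical
  have hT' : (0 : ℝ) < T := by exact_mod_cast hT
  rw [← mul_le_mul_iff_right₀ hT', mul_bias hT]
  calc ∑ i, |deviation E π y i| ≤ ∑ i, ∑ t, |residual (π t) (y t) i| := by
        refine Finset.sum_le_sum fun i _ => (Finset.abs_sum_le_sum_abs _ _).trans
          (Finset.sum_le_sum fun t _ => ?_)
        split_ifs <;> simp
    _ = ∑ t, ∑ i, |residual (π t) (y t) i| := Finset.sum_comm
    _ ≤ ∑ _t : Fin T, 2 := Finset.sum_le_sum fun t _ => sum_abs_residual_le _ _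
    _ = T * 2 := by simp

theorem hits_le (E : Set (Belief Y)) (π : Fin T → Belief Y) : hits E π ≤ T := by
  classical
  simpa [hits] using Finset.card_filter_le (Finset.univ : Finset (Fin T)) _

theorem deviation_eq_zero {E : Set (Belief Y)} {π : Fin T → Belief Y} (h : hits E π = 0)
    (y : Fin T → Y) (i : Y) : deviation E π y i = 0 := by
  classical
  rw [hits, Finset.card_eq_zero, Finset.filter_eq_empty_iff] at h
  exact Finset.sum_eq_zero fun t ht => if_neg (h ht)

theorem bias_of_subsingleton [Subsingleton Y] (E : Set (Belief Y)) (π : Fin T → Belief Y)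
    (y : Fin T → Y) : bias E π y = 0 := by
  have : ∀ (q : Belief Y) (z i : Y), residual q z i = 0 := by
    intro q z i
    have h := q.2.2
    rw [Fintype.sum_subsingleton _ i] at h
    simp [residual, Subsingleton.elim z i, h]
  simp [bias_eq, deviation, this]

/-- The excess of the bias over the square root term of the bias guarantee. -/
def biasExcess (κ : ℝ) (𝓔 : Finset (Set (Belief Y))) (π : Fin T → Belief Y) (y : Fin T → Y) : ℝ :=
  ⨆ E : {E // E ∈ 𝓔}, (bias E.1 π y - κ * (Fintype.card Y : ℝ) *
    √(Real.log ((Fintype.card Y : ℝ) * (𝓔.card : ℝ) * (T : ℝ)) * (hits E.1 π : ℝ)) / (T : ℝ))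

theorem le_biasExcess (κ : ℝ) {𝓔 : Finset (Set (Belief Y))} {E : Set (Belief Y)} (hE : E ∈ 𝓔)
    (π : Fin T → Belief Y) (y : Fin T → Y) :
    bias E π y - κ * (Fintype.card Y : ℝ) *
      √(Real.log ((Fintype.card Y : ℝ) * (𝓔.card : ℝ) * (T : ℝ)) * (hits E π : ℝ)) / (T : ℝ) ≤
    biasExcess κ 𝓔 π y :=
  le_ciSup (f := fun E : {E // E ∈ 𝓔} => (bias E.1 π y - κ * (Fintype.card Y : ℝ) *
    √(Real.log ((Fintype.card Y : ℝ) * (𝓔.card : ℝ) * (T : ℝ)) * (hits E.1 π : ℝ)) / (T : ℝ)))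
    (Set.finite_range _).bddAbove ⟨E, hE⟩

theorem biasExcess_le {κ : ℝ} {𝓔 : Finset (Set (Belief Y))} (h𝓔 : 𝓔.Nonempty)
    {π : Fin T → Belief Y} {y : Fin T → Y} {M : ℝ}
    (h : ∀ E ∈ 𝓔, bias E π y - κ * (Fintype.card Y : ℝ) *
      √(Real.log ((Fintype.card Y : ℝ) * (𝓔.card : ℝ) * (T : ℝ)) * (hits E π : ℝ)) / (T : ℝ) ≤ M) :
    biasExcess κ 𝓔 π y ≤ M := by
  have : Nonempty {E // E ∈ 𝓔} := h𝓔.to_subtype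
  exact ciSup_le fun E => h E.1 E.2

theorem biasExcess_bounded {κ : ℝ} (hκ : 0 ≤ κ) (hT : 0 < T) {𝓔 : Finset (Set (Belief Y))}
    (h𝓔 : 𝓔.Nonempty) (y : Fin T → Y) :
    ∃ M, ∀ π : Fin T → Belief Y, |biasExcess κ 𝓔 π y| ≤ M := by
  set l := Real.log ((Fintype.card Y : ℝ) * (𝓔.card : ℝ) * (T : ℝ))
  set B := κ * (Fintype.card Y : ℝ) * √(|l| * T) / T
  have hB : 0 ≤ B := by positivity
  have hle : ∀ (E : Set (Belief Y)) (π : Fin T → Belief Y),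
      κ * (Fintype.card Y : ℝ) * √(l * (hits E π : ℝ)) / (T : ℝ) ≤ B := by
    intro E π
    have : l * (hits E π : ℝ) ≤ |l| * T :=
      mul_le_mul (le_abs_self _) (by exact_mod_cast hits_le E π) (by positivity) (abs_nonneg _)
    simp only [B]
    gcongr
  refine ⟨2 + B, fun π => abs_le.2 ⟨?_, ?_⟩⟩
  · obtain ⟨E, hE⟩ := h𝓔
    refine le_trans ?_ (le_biasExcess κ hE π y)
    linarith [hle E π, bias_nonneg E π y]
  · refine biasExcess_le h𝓔 fun E _ => ?_
    have : 0 ≤ κ * (Fintype.card Y : ℝ) * √(l * (hits E π : ℝ)) / (T : ℝ) := by positivity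
    linarith [bias_le_two hT E π y]

/-- Tuning the learning rate `η` to the number `n` of rounds. -/
theorem le_of_rate_mul_sub_le {l S : ℝ} {n : ℕ} (hl : 0 < l) (hn : 0 < n)
    (h : min (1 / 2) √(l / n) * S - min (1 / 2) √(l / n) ^ 2 * n ≤ 3 * l) :
    S ≤ 4 * √(l * n) + 8 * l := by
  have hn' : (0 : ℝ) < n := by exact_mod_cast hn
  have hs : 0 < √(l / n) := by positivity
  have hs2 : √(l / n) ^ 2 * n = l := by
    rw [Real.sq_sqrt (by positivity)]; field_simp
  -- For many rounds the rate is `√(l / n)`, the compensator equals `l`, and `S ≤ 4 l / η = 4 √(l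
  -- n)`. For few rounds, `n ≤ 4 l`, the rate is capped at `1 / 2` and `S ≤ 8 l`.
  rcases le_total √(l / n) (1 / 2) with hc | hc
  · rw [min_eq_right hc, hs2] at h
    have hsn : √(l / n) * n = √(l * n) := by
      rw [← Real.sqrt_sq hn'.le, ← Real.sqrt_mul (by positivity), Real.sqrt_sq hn'.le]
      congr 1; field_simp
    have : √(l / n) * S ≤ √(l / n) * (4 * √(l * n)) := by
      rw [← hsn]; nlinarith
    have := le_of_mul_le_mul_left this hs
    linarith
  · rw [min_eq_left hc] at h
    have : (1 / 4 : ℝ) * n ≤ l := by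
      rw [← hs2]; gcongr; nlinarith
    linarith [Real.sqrt_nonneg (l * n)]

open Classical in
/-- The tests for the bias guarantee: the indicators of the events, with a sign and a rate. -/
def biasTest (𝓔 : Finset (Set (Belief Y))) (l : ℝ) (T : ℕ)
    (x : {E // E ∈ 𝓔} × Y × Bool × Fin T) (q : Belief Y) : ℝ :=
  if q ∈ x.1.1 then (if x.2.2.1 then 1 else -1) * min (1 / 2) √(l / ((x.2.2.2 : ℕ) + 1 : ℕ)) else 0

theorem abs_biasTest_le (𝓔 : Finset (Set (Belief Y))) (l : ℝ) (T : ℕ)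
    (x : {E // E ∈ 𝓔} × Y × Bool × Fin T) (q : Belief Y) : |biasTest 𝓔 l T x q| ≤ 1 / 2 := by
  have h : |min (1 / 2) √(l / ((x.2.2.2 : ℕ) + 1 : ℕ))| ≤ 1 / 2 := by
    rw [abs_of_nonneg (le_min (by norm_num) (Real.sqrt_nonneg _))]
    exact min_le_left _ _
  unfold biasTest
  split_ifs
  · rwa [one_mul]
  · rwa [neg_one_mul, abs_neg]
  · norm_num

theorem sum_biasTest (𝓔 : Finset (Set (Belief Y))) (l : ℝ)
    (x : {E // E ∈ 𝓔} × Y × Bool × Fin T) (π : Fin T → Belief Y) (y : Fin T → Y) :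
    ∑ t, (biasTest 𝓔 l T x (π t) * residual (π t) (y t) x.2.1 - biasTest 𝓔 l T x (π t) ^ 2) =
      min (1 / 2) √(l / ((x.2.2.2 : ℕ) + 1 : ℕ)) *
        ((if x.2.2.1 then 1 else -1) * deviation x.1.1 π y x.2.1) -
      min (1 / 2) √(l / ((x.2.2.2 : ℕ) + 1 : ℕ)) ^ 2 * hits x.1.1 π := by
  classical
  rw [deviation, hits, Finset.card_filter, Nat.cast_sum, Finset.mul_sum, Finset.mul_sum,
    Finset.mul_sum, ← Finset.sum_sub_distrib]
  refine Finset.sum_congr rfl fun t _ => ?_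
  unfold biasTest
  by_cases h : π t ∈ x.1.1 <;> by_cases h' : x.2.2.1 <;> simp [h, h']

/-- Each exponential is at most the whole potential, so every test score is at most `3 * l`. The two
signs give the absolute deviation, and summing over the states gives the factor `Fintype.card Y`. -/
theorem mul_bias_le_of_potential_le {𝓔 : Finset (Set (Belief Y))} {l : ℝ} (hl : 0 < l)
    (hT : 0 < T) {π : Fin T → Belief Y} {y : Fin T → Y}
    (h : potential (biasTest 𝓔 l T) (fun x => x.2.1) π y ≤ Real.exp (3 * l))
    {E : Set (Belief Y)} (hE : E ∈ 𝓔) :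
    T * bias E π y ≤ Fintype.card Y * (4 * √(l * hits E π) + 8 * l) := by
  rw [mul_bias hT]
  have hi : ∀ i, |deviation E π y i| ≤ 4 * √(l * hits E π) + 8 * l := by
    intro i
    rcases Nat.eq_zero_or_pos (hits E π) with h0 | hpos
    · rw [deviation_eq_zero h0, abs_zero]; positivity
    have key : ∀ b : Bool, (if b then 1 else -1) * deviation E π y i ≤
        4 * √(l * hits E π) + 8 * l := by
      intro b
      have hk : hits E π - 1 < T := by have := hits_le E π; omega
      -- The rate with index `k` is tuned to `k + 1` hits. Having a test for every possible hit
      -- count removes the need to know it in advance; zero hits were treated separately.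
      set x : {E // E ∈ 𝓔} × Y × Bool × Fin T := ⟨⟨E, hE⟩, i, b, ⟨hits E π - 1, hk⟩⟩ with hx
      have h1 := (Finset.single_le_sum (f := fun x => Real.exp (∑ t, (biasTest 𝓔 l T x (π t) *
        residual (π t) (y t) x.2.1 - biasTest 𝓔 l T x (π t) ^ 2)))
        (fun _ _ => (Real.exp_pos _).le) (Finset.mem_univ x)).trans h
      rw [Real.exp_le_exp, sum_biasTest] at h1
      simp only [hx, Nat.sub_add_cancel hpos] at h1
      exact le_of_rate_mul_sub_le hl hpos h1
    rw [abs_le']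
    exact ⟨by simpa using key true, by simpa using key false⟩
  calc ∑ i, |deviation E π y i| ≤ ∑ _i : Y, (4 * √(l * hits E π) + 8 * l) :=
        Finset.sum_le_sum fun i _ => hi i
    _ = _ := by rw [Finset.sum_const, Finset.card_univ, nsmul_eq_mul]

theorem exists_forecaster_hasBiasGuarantee [Nonempty Y] (hT : 0 < T)
    {𝓔 : Finset (Set (Belief Y))} (h𝓔 : 𝓔.Nonempty) :
    ∃ F : Forecaster Y, HasBiasGuarantee 10 F 𝓔 T := by
  classical
  have hT1 : (1 : ℝ) ≤ T := by exact_mod_cast hT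
  have hE1 : (1 : ℝ) ≤ 𝓔.card := by exact_mod_cast h𝓔.card_pos
  have hY1 : (1 : ℝ) ≤ Fintype.card Y := by exact_mod_cast Fintype.card_pos
  set N : ℝ := (Fintype.card Y : ℝ) * (𝓔.card : ℝ) * (T : ℝ) with hN
  have hN1 : 1 ≤ N := one_le_mul_of_one_le_of_one_le
    (one_le_mul_of_one_le_of_one_le hY1 hE1) hT1
  set l := Real.log N with hl
  have hl0 : 0 ≤ l := Real.log_nonneg hN1
  obtain ⟨F, hF⟩ := exists_forecaster_potential_le (biasTest 𝓔 l T) (fun x => x.2.1)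
    (abs_biasTest_le 𝓔 l T) one_pos
  refine ⟨F, fun y => ?_⟩
  change expect (forecastLaw F T y) (fun π => biasExcess 10 𝓔 π y) ≤ 10 * Fintype.card Y * l / T
  have hbd := biasExcess_bounded (κ := 10) (by norm_num) hT h𝓔 y
  -- With a single state `l` may vanish, but then there is no bias at all; with two states or more
  -- `l ≥ log 2`.
  rcases subsingleton_or_nontrivial Y with hY | hY
  · have h0 : expect (forecastLaw F T y) (fun π => biasExcess 10 𝓔 π y) ≤
        expect (forecastLaw F T y) fun _ => 0 := by
      refine expect_mono _ hbd ⟨0, by simp⟩ fun π => biasExcess_le h𝓔 fun E _ => ?_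
      rw [bias_of_subsingleton, zero_sub]
      exact neg_nonpos.2 (by positivity)
    rw [expect_const] at h0
    exact h0.trans (by positivity)
  have hY2 : (2 : ℝ) ≤ Fintype.card Y := by exact_mod_cast Fintype.one_lt_card
  have hN2 : 2 * (T : ℝ) ≤ N := by
    rw [hN]; gcongr; nlinarith
  have hl2 : 0.69 ≤ l := by
    have := Real.log_two_gt_d9
    have := Real.log_le_log two_pos (by linarith : 2 ≤ N)
    linarith
  have hexp : Real.exp l = N := Real.exp_log (by linarith)
  have hexp3 : Real.exp (3 * l) = N ^ 3 := by
    rw [← hexp, ← Real.exp_nat_mul]; norm_num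
  -- A pointwise form of Markov's inequality: if the potential exceeds `exp (3 * l) = N ^ 3`, then
  -- `c * Φ` exceeds 2, the trivial bound on the bias.
  set c := 2 / N ^ 3 with hc
  set Φ := fun π : Fin T → Belief Y => potential (biasTest 𝓔 l T) (fun x => x.2.1) π y with hΦ
  have hΦ0 : ∀ π, 0 ≤ Φ π := fun π => potential_nonneg _ _ _ _
  have hΦb : ∃ M, ∀ π, |Φ π| ≤ M := ⟨_, fun π => by
    rw [abs_of_nonneg (hΦ0 π)]; exact potential_le (abs_biasTest_le 𝓔 l T) π y⟩
  have hcΦb : ∃ M, ∀ π, |c * Φ π| ≤ M := by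
    obtain ⟨M, hM⟩ := hΦb
    exact ⟨|c| * M, fun π => by rw [abs_mul]; gcongr; exact hM π⟩
  have hc0 : 0 ≤ c := by positivity
  have hpt : ∀ π, biasExcess 10 𝓔 π y ≤ 8 * Fintype.card Y * l / T + c * Φ π := by
    refine fun π => biasExcess_le h𝓔 fun E hE => ?_
    have hsq : 0 ≤ Fintype.card Y * √(l * hits E π) := by positivity
    have hcΦ : 0 ≤ c * Φ π := mul_nonneg hc0 (hΦ0 π)
    have hfr : 0 ≤ 8 * Fintype.card Y * l / T := by positivity
    rw [sub_le_iff_le_add]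
    by_cases hgood : Φ π ≤ Real.exp (3 * l)
    · have := mul_bias_le_of_potential_le (by linarith) hT hgood hE
      rw [mul_comm, ← le_div_iff₀ (by linarith)] at this
      calc bias E π y ≤ _ := this
        _ ≤ (8 * Fintype.card Y * l + 10 * Fintype.card Y * √(l * hits E π)) / T := by
            gcongr; linarith
        _ = 8 * Fintype.card Y * l / T + 10 * Fintype.card Y * √(l * hits E π) / T := add_div _ _ _
        _ ≤ _ := by linarith
    · have h2 : 2 ≤ c * Φ π := by
        rw [not_le, hexp3] at hgood
        rw [hc, div_mul_eq_mul_div, le_div_iff₀ (by positivity)]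
        linarith
      have : 0 ≤ 10 * Fintype.card Y * √(l * hits E π) / T := by positivity
      linarith [bias_le_two hT E π y]
  have hcard : (Fintype.card ({E // E ∈ 𝓔} × Y × Bool × Fin T) : ℝ) = 2 * N := by
    simp [hN]; ring
  have hΦe := hF T y
  rw [hcard, mul_one] at hΦe
  calc expect (forecastLaw F T y) (fun π => biasExcess 10 𝓔 π y)
      ≤ expect (forecastLaw F T y) (fun π => 8 * Fintype.card Y * l / T + c * Φ π) := by
        refine expect_mono _ hbd ?_ hpt
        obtain ⟨M, hM⟩ := hcΦb
        exact ⟨_, fun π => (abs_add_le _ _).trans (add_le_add le_rfl (hM π))⟩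
    _ = 8 * Fintype.card Y * l / T + c * expect (forecastLaw F T y) Φ := by
        rw [expect_add _ ⟨_, fun _ => le_rfl⟩ hcΦb, expect_const, expect_const_mul]
    -- The `2 * N` tests start with exponential 1 each, and drift 1 per round adds `T ≤ N`.
    _ ≤ 8 * Fintype.card Y * l / T + c * (3 * N) := by
        gcongr; linarith
    -- The failure term is `6 / N ^ 2`, which is at most `1.5 / T` because `N ≥ 2 * T`; together
    -- with the 8 from the good case the constant becomes 10.
    _ ≤ 8 * Fintype.card Y * l / T + 2 * Fintype.card Y * l / T := by
        gcongr
        have h1 : c * (3 * N) = 6 / N ^ 2 := by rw [hc]; field_simp; norm_num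
        rw [h1, div_le_div_iff₀ (by positivity) (by positivity)]
        have h2 : 1.38 ≤ Fintype.card Y * l := by nlinarith
        have h3 : 4 * (T : ℝ) ≤ N ^ 2 := by nlinarith
        nlinarith
    _ = _ := by ring

end Bias

/-! ### The transfer inequality on one cell -/

section Cells

variable {A Y : Type*} {T : ℕ}

theorem empirical_nonneg (I : Finset (Fin T)) (a : Fin T → A) (b : A) : 0 ≤ empirical I a b := by
  unfold empirical; positivity

theorem sum_empirical [Fintype A] {I : Finset (Fin T)} (hI : I.Nonempty) (a : Fin T → A) :
    ∑ b, empirical I a b = 1 := by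
  classical
  have h : (I.card : ℝ) ≠ 0 := by exact_mod_cast hI.card_pos.ne'
  have h2 := Finset.card_eq_sum_card_fiberwise (f := a) (s := I) (t := Finset.univ)
    fun _ _ => Finset.mem_coe.2 (Finset.mem_univ _)
  simp only [empirical]
  rw [← Finset.sum_div, div_eq_one_iff_eq h]
  exact_mod_cast h2.symm

/-- The difference between the realized utility in the rounds `I` and that of the empirical
distribution of the actions in these rounds. -/
def secretGain [Fintype A] (w : A → Y → ℝ) (I : Finset (Fin T)) (y : Fin T → Y) (a : Fin T → A) :
    ℝ :=
  ∑ t ∈ I, (w (a t) (y t) - ∑ b, empirical I a b * w b (y t))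

theorem sum_realized_eq [Fintype A] (w : A → Y → ℝ) (I : Finset (Fin T)) (y : Fin T → Y)
    (a : Fin T → A) :
    ∑ t ∈ I, w (a t) (y t) =
      secretGain w I y a + ∑ b, empirical I a b * ∑ t ∈ I, w b (y t) := by
  simp_rw [secretGain, Finset.sum_sub_distrib, Finset.mul_sum]
  rw [Finset.sum_comm]
  ring

variable [Fintype Y]

theorem abs_sum_belief_sub_le (I : Finset (Fin T)) (π : Fin T → Belief Y) (y : Fin T → Y)
    {w : Y → ℝ} (hw : ∀ i, |w i| ≤ 1) :
    |∑ t ∈ I, (∑ i, (π t).1 i * w i - w (y t))| ≤ ∑ i, |∑ t ∈ I, residual (π t) (y t) i| := by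
  classical
  have h : ∀ t, ∑ i, (π t).1 i * w i - w (y t) = ∑ i, residual (π t) (y t) i * w i := by
    intro t
    simp [residual, sub_mul, Finset.sum_sub_distrib]
  simp_rw [h]
  rw [Finset.sum_comm]
  refine (Finset.abs_sum_le_sum_abs _ _).trans (Finset.sum_le_sum fun i _ => ?_)
  rw [← Finset.sum_mul, abs_mul]
  exact mul_le_of_le_one_right (abs_nonneg _) (hw i)

/-- A lower bound `v` on the forecast utility `w`, up to `lam` times the forecast regret with
respect to the action `s`, carries over to the realized utilities in the rounds `I`. -/
theorem sum_realized_ge [Fintype A] {u w : A → Y → ℝ} (hu : ∀ b i, |u b i| ≤ 1)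
    (hw : ∀ b i, |w b i| ≤ 1) (I : Finset (Fin T)) (π : Fin T → Belief Y) (y : Fin T → Y)
    (a : Fin T → A) (s : A) (v : Fin T → ℝ) {lam : ℝ} (hlam : 0 ≤ lam)
    (h : ∀ t ∈ I, ∀ b, v t ≤ ∑ i, (π t).1 i * w b i +
      lam * (∑ i, (π t).1 i * u s i - ∑ i, (π t).1 i * u b i)) :
    ∑ t ∈ I, v t ≤ ∑ t ∈ I, w (a t) (y t) + |secretGain w I y a| +
      ∑ i, |∑ t ∈ I, residual (π t) (y t) i| +
      lam * (∑ t ∈ I, (u s (y t) - u (a t) (y t)) + |secretGain u I y a| +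
        2 * ∑ i, |∑ t ∈ I, residual (π t) (y t) i|) := by
  rcases I.eq_empty_or_nonempty with rfl | hI
  · simp [secretGain]
  set B := ∑ i, |∑ t ∈ I, residual (π t) (y t) i|
  have hsum := sum_empirical hI a
  have hb : ∀ b, ∑ t ∈ I, v t ≤ ∑ t ∈ I, w b (y t) + B +
      lam * (∑ t ∈ I, u s (y t) - ∑ t ∈ I, u b (y t) + 2 * B) := by
    intro b
    have h1 := Finset.sum_le_sum fun t ht => h t ht b
    rw [Finset.sum_add_distrib, ← Finset.mul_sum, Finset.sum_sub_distrib] at h1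
    have hw' := (abs_le.1 (abs_sum_belief_sub_le I π y (hw b))).2
    have hs := (abs_le.1 (abs_sum_belief_sub_le I π y (hu s))).2
    have hb := (abs_le.1 (abs_sum_belief_sub_le I π y (hu b))).1
    rw [Finset.sum_sub_distrib] at hw' hs hb
    have h2 := mul_le_mul_of_nonneg_left (a := lam)
      (b := ∑ t ∈ I, ∑ i, (π t).1 i * u s i - ∑ t ∈ I, ∑ i, (π t).1 i * u b i)
      (c := ∑ t ∈ I, u s (y t) - ∑ t ∈ I, u b (y t) + 2 * B) (by linarith) hlam
    linarith
  -- Averaging with the empirical frequencies is legitimate because the weights are nonnegative and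
  -- sum to 1, and because the bound is affine in the utilities of `b`.
  have havg := Finset.sum_le_sum fun b (_ : b ∈ Finset.univ) =>
    mul_le_mul_of_nonneg_left (hb b) (empirical_nonneg I a b)
  rw [← Finset.sum_mul, hsum, one_mul] at havg
  have hexpand : ∑ b, empirical I a b * (∑ t ∈ I, w b (y t) + B +
      lam * (∑ t ∈ I, u s (y t) - ∑ t ∈ I, u b (y t) + 2 * B)) =
      ∑ b, empirical I a b * ∑ t ∈ I, w b (y t) + B +
      lam * (∑ t ∈ I, u s (y t) - ∑ b, empirical I a b * ∑ t ∈ I, u b (y t) + 2 * B) := by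
    calc _ = ∑ b, (empirical I a b * ∑ t ∈ I, w b (y t) +
          empirical I a b * (B + lam * (∑ t ∈ I, u s (y t) + 2 * B)) -
          lam * (empirical I a b * ∑ t ∈ I, u b (y t))) :=
          Finset.sum_congr rfl fun b _ => by ring
      _ = _ := by
          rw [Finset.sum_sub_distrib, Finset.sum_add_distrib, ← Finset.sum_mul, hsum,
            ← Finset.mul_sum]
          ring
  rw [hexpand] at havg
  rw [sum_realized_eq w I y a, Finset.sum_sub_distrib, sum_realized_eq u I y a]
  have h1 := neg_abs_le (secretGain w I y a)
  have h2 := mul_le_mul_of_nonneg_left (le_abs_self (secretGain u I y a)) hlam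
  linarith

end Cells

/-! ### Summation over cells and over the actions of the Agent -/

section Rounds

variable {P A Y : Type*} {T : ℕ}

theorem sum_rounds [Fintype A] (p : Fin T → P) (r : Fin T → A) {Q : Finset P} (hQ : ∀ t, p t ∈ Q)
    (f : Fin T → ℝ) :
    ∑ x ∈ Q ×ˢ (Finset.univ : Finset A), ∑ t ∈ rounds p r x.1 x.2, f t = ∑ t, f t := by
  classical
  rw [← Finset.sum_fiberwise_of_maps_to (s := Finset.univ) (t := Q ×ˢ (Finset.univ : Finset A))
    (g := fun t => (p t, r t)) fun t _ => by simp [hQ t]]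
  refine Finset.sum_congr rfl fun x _ => Finset.sum_congr ?_ fun _ _ => rfl
  ext t
  simp [rounds, Prod.ext_iff]

theorem sum_sqrt_le {X : Type*} (s : Finset X) {n : X → ℝ} (hn : ∀ x ∈ s, 0 ≤ n x) :
    ∑ x ∈ s, √(n x) ≤ √(s.card * ∑ x ∈ s, n x) := by
  refine Real.le_sqrt_of_sq_le ((sq_sum_le_card_mul_sum_sq).trans_eq ?_)
  rw [Finset.sum_congr rfl fun x hx => Real.sq_sqrt (hn x hx)]

theorem sum_sqrt_card_rounds_le [Fintype A] (p : Fin T → P) (r : Fin T → A) {Q : Finset P}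
    (hQ : ∀ t, p t ∈ Q) :
    ∑ x ∈ Q ×ˢ (Finset.univ : Finset A), √((rounds p r x.1 x.2).card : ℝ) ≤
      T * √(Q.card * Fintype.card A / T) := by
  have h := sum_rounds p r hQ fun _ => 1
  simp only [Finset.sum_const, nsmul_eq_mul, mul_one, Finset.card_univ, Fintype.card_fin] at h
  refine (sum_sqrt_le _ fun _ _ => Nat.cast_nonneg _).trans_eq ?_
  rw [h, Finset.card_product, Finset.card_univ, Nat.cast_mul]
  rcases Nat.eq_zero_or_pos T with rfl | hT
  · simp
  · have hT' : (0 : ℝ) < T := by exact_mod_cast hT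
    rw [← Real.sqrt_sq hT'.le, ← Real.sqrt_mul (by positivity), Real.sqrt_sq hT'.le]
    congr 1
    field_simp

theorem NoSecretInfoFor.expect_le [Fintype A] {W : A → P → Y → ℝ} {K : ℝ}
    {L : AgentAlgorithm P A Y} {y : Fin T → Y} {p : Fin T → P} {r : Fin T → A}
    (h : NoSecretInfoFor W K L y p r) (q : P) (s : A) :
    expect (actionLaw L T y p r)
      (fun a => |secretGain (fun b => W b q) (rounds p r q s) y a|) ≤
      K * √((rounds p r q s).card : ℝ) := by
  have h1 := h q s
  rcases (rounds p r q s).eq_empty_or_nonempty with h0 | h0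
  · simp [secretGain, h0]
  · have hn : (0 : ℝ) < (rounds p r q s).card := by exact_mod_cast h0.card_pos
    rw [one_div, inv_mul_le_iff₀ hn] at h1
    refine h1.trans_eq ?_
    rw [mul_div_assoc', mul_comm, mul_div_assoc, Real.div_sqrt]

/-- Upper bounds on the benchmark payoff come from applying the transfer inequality to `-V`. -/
theorem NoSecretInfoFor.neg [Fintype A] {W : A → P → Y → ℝ} {K : ℝ}
    {L : AgentAlgorithm P A Y} {y : Fin T → Y} {p : Fin T → P} {r : Fin T → A}
    (h : NoSecretInfoFor W K L y p r) : NoSecretInfoFor (fun a p y => -W a p y) K L y p r := by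
  intro q s
  convert h q s using 4 with a
  rw [← abs_neg, ← Finset.sum_neg_distrib]
  congr 1
  refine Finset.sum_congr rfl fun t _ => ?_
  simp [Finset.sum_neg_distrib]
  ring

variable (G : Game P A Y)

theorem Game.abs_U_le (a : A) (p : P) (y : Y) : |G.U a p y| ≤ 1 := abs_le.2 (G.U_mem a p y)

theorem Game.abs_V_le (a : A) (p : P) (y : Y) : |G.V a p y| ≤ 1 := abs_le.2 (G.V_mem a p y)

/-- There may be infinitely many policies, hence infinitely many swap maps, so boundedness of the
supremum comes from the gain of at most 2 per round. -/
theorem le_swapRegret_integrand (y : Fin T → Y) (p : Fin T → P) (r a : Fin T → A)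
    (h : P → A → A → A) :
    1 / (T : ℝ) * ∑ t, (G.U (h (p t) (r t) (a t)) (p t) (y t) - G.U (a t) (p t) (y t)) ≤
      ⨆ h : P → A → A → A,
        1 / (T : ℝ) * ∑ t, (G.U (h (p t) (r t) (a t)) (p t) (y t) - G.U (a t) (p t) (y t)) := by
  refine le_ciSup (f := fun h : P → A → A → A => 1 / (T : ℝ) *
    ∑ t, (G.U (h (p t) (r t) (a t)) (p t) (y t) - G.U (a t) (p t) (y t)))
    ⟨1 / (T : ℝ) * ∑ _t : Fin T, 2, ?_⟩ h
  rintro _ ⟨h, rfl⟩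
  refine mul_le_mul_of_nonneg_left (Finset.sum_le_sum fun t _ => ?_) (by positivity)
  linarith [(G.U_mem (h (p t) (r t) (a t)) (p t) (y t)).2, (G.U_mem (a t) (p t) (y t)).1]

theorem swapRegret_nonneg [Fintype A] (L : AgentAlgorithm P A Y) (y : Fin T → Y) (p : Fin T → P)
    (r : Fin T → A) : 0 ≤ swapRegret G L y p r := by
  refine tsum_nonneg fun a => mul_nonneg ENNReal.toReal_nonneg ?_
  simpa using le_swapRegret_integrand G y p r a fun _ _ a => a

variable [Fintype A] [Fintype Y]

/-- A lower bound on the forecast utilities `W`, up to a multiple of the forecast regret of the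
Agent, carries over to the expected realized utilities. -/
theorem average_le_expect_of_le {W : A → P → Y → ℝ} (hW : ∀ a p y, |W a p y| ≤ 1) (hT : 0 < T)
    {K : ℝ} (hK : 0 ≤ K) {L : AgentAlgorithm P A Y} {y : Fin T → Y} {p : Fin T → P}
    {r : Fin T → A} {π : Fin T → Belief Y} {Q : Finset P} (hQ : ∀ t, p t ∈ Q)
    {E : P → A → Set (Belief Y)} (hE : ∀ q ∈ Q, ∀ s t, π t ∈ E q s ↔ p t = q ∧ r t = s)
    (hsU : NoSecretInfoFor G.U K L y p r) (hsW : NoSecretInfoFor W K L y p r) {εs : ℝ}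
    (hswap : swapRegret G L y p r ≤ εs) {v : Fin T → ℝ} {lam : ℝ} (hlam : 0 ≤ lam)
    (h : ∀ t b, v t ≤ ∑ i, (π t).1 i * W b (p t) i +
      lam * (G.expU (r t) (p t) (π t) - G.expU b (p t) (π t))) :
    1 / (T : ℝ) * ∑ t, v t ≤
      expect (actionLaw L T y p r) (fun a => 1 / (T : ℝ) * ∑ t, W (a t) (p t) (y t)) +
      ∑ x ∈ Q ×ˢ (Finset.univ : Finset A), bias (E x.1 x.2) π y +
      K * √(Q.card * Fintype.card A / T) +
      lam * (εs + K * √(Q.card * Fintype.card A / T) +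
        2 * ∑ x ∈ Q ×ˢ (Finset.univ : Finset A), bias (E x.1 x.2) π y) := by
  classical
  have hT' : (0 : ℝ) < T := by exact_mod_cast hT
  set X := Q ×ˢ (Finset.univ : Finset A)
  set N := √(Q.card * Fintype.card A / T : ℝ)
  set b := ∑ x ∈ X, bias (E x.1 x.2) π y
  set μ := actionLaw L T y p r
  have hbias : ∑ x ∈ X, ∑ i, |∑ t ∈ rounds p r x.1 x.2, residual (π t) (y t) i| = T * b := by
    rw [Finset.mul_sum]
    refine Finset.sum_congr rfl fun x hx => ?_
    rw [mul_bias hT]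
    refine Finset.sum_congr rfl fun i _ => ?_
    rw [deviation, ← Finset.sum_filter]
    congr 2
    ext t
    simp [rounds, hE x.1 (Finset.mem_product.1 hx).1 x.2 t]
  set sw := fun a : Fin T → A => ⨆ h : P → A → A → A,
    1 / (T : ℝ) * ∑ t, (G.U (h (p t) (r t) (a t)) (p t) (y t) - G.U (a t) (p t) (y t)) with hsw
  have hpt : ∀ a : Fin T → A, ∑ t, v t ≤ (T * (1 / (T : ℝ) * ∑ t, W (a t) (p t) (y t)) +
      ∑ x ∈ X, |secretGain (fun b => W b x.1) (rounds p r x.1 x.2) y a|) + (T * b +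
      lam * (2 * (T * b))) + (lam * T * sw a +
      lam * ∑ x ∈ X, |secretGain (fun b => G.U b x.1) (rounds p r x.1 x.2) y a|) := by
    intro a
    have hcell := Finset.sum_le_sum fun x (_ : x ∈ X) =>
      sum_realized_ge (u := fun b => G.U b x.1) (w := fun b => W b x.1)
        (fun b i => G.abs_U_le b x.1 i) (fun b i => hW b x.1 i) (rounds p r x.1 x.2) π y a x.2 v
        hlam fun t ht b => by
          obtain ⟨h1, h2⟩ := (Finset.mem_filter.1 ht).2
          rw [← h1, ← h2]
          exact h t b
    simp only [Finset.sum_add_distrib, ← Finset.mul_sum, hbias] at hcell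
    have e1 : ∑ x ∈ X, ∑ t ∈ rounds p r x.1 x.2, W (a t) x.1 (y t) =
        ∑ t, W (a t) (p t) (y t) := by
      rw [← sum_rounds p r hQ]
      refine Finset.sum_congr rfl fun x _ => Finset.sum_congr rfl fun t ht => ?_
      rw [(Finset.mem_filter.1 ht).2.1]
    have e2 : ∑ x ∈ X, ∑ t ∈ rounds p r x.1 x.2, (G.U x.2 x.1 (y t) - G.U (a t) x.1 (y t)) =
        ∑ t, (G.U (r t) (p t) (y t) - G.U (a t) (p t) (y t)) := by
      rw [← sum_rounds p r hQ]
      refine Finset.sum_congr rfl fun x _ => Finset.sum_congr rfl fun t ht => ?_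
      rw [(Finset.mem_filter.1 ht).2.1, (Finset.mem_filter.1 ht).2.2]
    rw [sum_rounds p r hQ, e1, e2] at hcell
    -- The swap map that always returns the recommendation is the only one needed.
    have h3 : ∑ t, (G.U (r t) (p t) (y t) - G.U (a t) (p t) (y t)) ≤ T * sw a := by
      have := mul_le_mul_of_nonneg_left (le_swapRegret_integrand G y p r a fun _ r _ => r) hT'.le
      rwa [← mul_assoc, mul_one_div_cancel hT'.ne', one_mul] at this
    have h4 := mul_le_mul_of_nonneg_left h3 hlam
    have h5 : (T : ℝ) * (1 / (T : ℝ) * ∑ t, W (a t) (p t) (y t)) = ∑ t, W (a t) (p t) (y t) := by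
      field_simp
    rw [h5]
    linarith
  have hexp := expect_mono μ (bounded_of_finite _) (bounded_of_finite _) hpt
  have bf : ∀ f : (Fin T → A) → ℝ, ∃ M, ∀ x, |f x| ≤ M := bounded_of_finite
  have hlin : ∀ (f₁ f₂ f₃ f₄ : (Fin T → A) → ℝ) (k₀ k₁ k₃ k₄ : ℝ),
      expect μ (fun a => (k₁ * f₁ a + f₂ a) + k₀ + (k₃ * f₃ a + k₄ * f₄ a)) =
        (k₁ * expect μ f₁ + expect μ f₂) + k₀ + (k₃ * expect μ f₃ + k₄ * expect μ f₄) := by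
    intros
    rw [expect_add μ (bf _) (bf _), expect_add μ (bf _) (bf _), expect_add μ (bf _) (bf _),
      expect_add μ (bf _) (bf _), expect_const, expect_const_mul, expect_const_mul,
      expect_const_mul]
  rw [expect_const, hlin, expect_sum, expect_sum] at hexp
  have hN := mul_le_mul_of_nonneg_left (sum_sqrt_card_rounds_le p r hQ) hK
  rw [Finset.mul_sum] at hN
  have hW' := (Finset.sum_le_sum fun x (_ : x ∈ X) => hsW.expect_le x.1 x.2).trans hN
  have hU' := mul_le_mul_of_nonneg_left
    ((Finset.sum_le_sum fun x (_ : x ∈ X) => hsU.expect_le x.1 x.2).trans hN) hlam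
  have hS : lam * T * expect μ sw ≤ lam * T * εs :=
    mul_le_mul_of_nonneg_left hswap (by positivity)
  rw [← mul_le_mul_iff_right₀ hT', ← mul_assoc, mul_one_div_cancel hT'.ne', one_mul]
  change _ ≤ T * (_ + b + K * N + lam * (εs + K * N + 2 * b))
  calc _ ≤ _ := hexp
    _ ≤ _ := by
      rw [mul_add, mul_add, mul_add]
      linarith

end Rounds

/-! ### Payoffs of the oracle and of the benchmarks -/

section Regret

variable {P A Y : Type*} [Fintype Y] {G : Game P A Y} {ε : ℝ}

theorem abs_expectation_le_one {w : Y → ℝ} (hw : ∀ i, |w i| ≤ 1) (π : Belief Y) :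
    |∑ i, π.1 i * w i| ≤ 1 := by
  refine (Finset.abs_sum_le_sum_abs _ _).trans ?_
  rw [← π.2.2]
  refine Finset.sum_le_sum fun i _ => ?_
  rw [abs_mul, abs_of_nonneg (π.2.1 i)]
  exact mul_le_of_le_one_right (π.2.1 i) (hw i)

theorem Game.abs_expV_le (a : A) (p : P) (π : Belief Y) : |G.expV a p π| ≤ 1 :=
  abs_expectation_le_one (fun i => G.abs_V_le a p i) π

/-- The forecasts for which the oracle chooses `q` and the recommendation is `s`. -/
def Selection.oracleCell (S : Selection G ε) (O : Belief Y → P) (q : P) (s : A) :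
    Set (Belief Y) := {π | O π = q ∧ S.astar (O π) π = s}

/-- The forecasts for which the best response to `q` is `s`. -/
def Selection.responseCell (S : Selection G ε) (q : P) (s : A) : Set (Belief Y) :=
  {π | S.astar q π = s}

variable [Fintype A] {T : ℕ} {S : Selection G ε} {c β γ K : ℝ} {PO : Finset P}
  {O : Belief Y → P} {L : AgentAlgorithm P A Y} {y : Fin T → Y} {π : Fin T → Belief Y} {εs : ℝ}

/-- Stability makes `2 / β` a sufficient penalty: an action that costs the Principal more than `γ`
has forecast regret at least `β`, and the resulting penalty 2 exceeds any possible loss of `V`. -/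
theorem average_optimistic_le_payoff_oracle (hβ : 0 < β) (hγ : 0 ≤ γ)
    (hO : S.IsOptimalStableOracle c β γ PO O) (hT : 0 < T) (hK : 0 ≤ K)
    (hswap : S.NoSwapRegret O L εs y π) (hsec : S.NoSecretInfo O L K y π) :
    1 / (T : ℝ) * ∑ t, (G.expV (S.astar (O (π t)) (π t)) (O (π t)) (π t) - γ) ≤
      S.payoff L y (fun t => O (π t)) π +
      ∑ x ∈ PO ×ˢ (Finset.univ : Finset A), bias (S.oracleCell O x.1 x.2) π y +
      K * √(PO.card * Fintype.card A / T) +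
      2 / β * (εs + K * √(PO.card * Fintype.card A / T) +
        2 * ∑ x ∈ PO ×ˢ (Finset.univ : Finset A), bias (S.oracleCell O x.1 x.2) π y) := by
  refine average_le_expect_of_le G G.abs_V_le hT hK (fun t => (hO (π t)).1)
    (fun q _ s t => Iff.rfl) hsec.1.1 hsec.1.2 hswap.1 (by positivity) fun t b => ?_
  change _ ≤ G.expV b (O (π t)) (π t) + 2 / β * (G.expU (S.astar (O (π t)) (π t)) (O (π t)) (π t)
    - G.expU b (O (π t)) (π t))
  have hbest := S.astar_mem (O (π t)) (π t) b
  have hpos := mul_nonneg (by positivity : 0 ≤ 2 / β) (sub_nonneg.2 hbest)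
  by_cases hb : b = S.astar (O (π t)) (π t)
  · subst hb; linarith
  rcases (hO (π t)).2.1 b hb with h | h
  · have h2 : 2 ≤ 2 / β * (G.expU (S.astar (O (π t)) (π t)) (O (π t)) (π t) -
        G.expU b (O (π t)) (π t)) := by
      rw [div_mul_eq_mul_div, le_div_iff₀ hβ]; linarith
    have h3 := (abs_le.1 (G.abs_expV_le b (O (π t)) (π t))).1
    have h4 := (abs_le.1 (G.abs_expV_le (S.astar (O (π t)) (π t)) (O (π t)) (π t))).2
    linarith
  · linarith

/-- An `ε`-best response is no better for the Principal than `aopt`; any other action is penalized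
by at least 2. There is one policy, so only the cells given by the recommendation occur. -/
theorem payoff_benchmark_le (hε : 0 < ε) (hT : 0 < T) (hK : 0 ≤ K) {p₀ : P}
    (hp₀ : p₀ ∈ G.benchmark)
    (hswap : S.NoSwapRegret O L εs y π) (hsec : S.NoSecretInfo O L K y π) :
    S.payoff L y (fun _ => p₀) π ≤
      1 / (T : ℝ) * ∑ t, G.expV (S.aopt p₀ (π t)) p₀ (π t) +
      ∑ a, bias (S.responseCell p₀ a) π y + K * √(Fintype.card A / T) +
      2 / ε * (εs + K * √(Fintype.card A / T) + 2 * ∑ a, bias (S.responseCell p₀ a) π y) := by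
  have h := average_le_expect_of_le G (W := fun a p y => -G.V a p y) (Q := {p₀})
    (E := S.responseCell) (v := fun t => -G.expV (S.aopt p₀ (π t)) p₀ (π t)) (lam := 2 / ε)
    (fun a p y => by rw [abs_neg]; exact G.abs_V_le a p y) hT hK (fun _ => Finset.mem_singleton_self _)
    (fun q hq s t => by rw [Finset.mem_singleton.1 hq]; exact (and_iff_right rfl).symm)
    (hsec.2 p₀ hp₀).1 (hsec.2 p₀ hp₀).2.neg (hswap.2 p₀ hp₀) (by positivity) fun t b => by
      have e : ∑ i, (π t).1 i * -G.V b p₀ i = -G.expV b p₀ (π t) := by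
        simp [Game.expV]
      rw [e]
      have hbest := S.astar_mem p₀ (π t) b
      have hpos := mul_nonneg (by positivity : 0 ≤ 2 / ε) (sub_nonneg.2 hbest)
      change _ ≤ _ + 2 / ε * (G.expU (S.astar p₀ (π t)) p₀ (π t) - _)
      by_cases hb : b ∈ G.approxResponses S.astar p₀ (π t) ε
      · have := S.aopt_max p₀ (π t) b hb
        linarith
      · have hb' : G.expU b p₀ (π t) < G.expU (S.astar p₀ (π t)) p₀ (π t) - ε := not_le.1 hb
        have h2 : 2 ≤ 2 / ε * (G.expU (S.astar p₀ (π t)) p₀ (π t) - G.expU b p₀ (π t)) := by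
          rw [div_mul_eq_mul_div, le_div_iff₀ hε]; linarith
        have h3 := (abs_le.1 (G.abs_expV_le b p₀ (π t))).2
        have h4 := (abs_le.1 (G.abs_expV_le (S.aopt p₀ (π t)) p₀ (π t))).1
        linarith
  have e : expect (actionLaw L T y (fun _ => p₀) (S.recommend (fun _ => p₀) π))
      (fun a => 1 / (T : ℝ) * ∑ t, -G.V (a t) p₀ (y t)) = -S.payoff L y (fun _ => p₀) π := by
    simp_rw [Finset.sum_neg_distrib, mul_neg]
    exact expect_neg _ _
  rw [e] at h
  simp only [Finset.sum_product, Finset.sum_singleton, Finset.card_singleton, Nat.cast_one, one_mul,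
    Finset.sum_neg_distrib, mul_neg] at h
  linarith

theorem regret_benchmark_le (hε : 0 < ε) (hβ : 0 < β) (hγ : 0 ≤ γ)
    (hO : S.IsOptimalStableOracle c β γ PO O) (hT : 0 < T) (hK : 0 ≤ K)
    (hswap : S.NoSwapRegret O L εs y π) (hsec : S.NoSecretInfo O L K y π) {p₀ : P}
    (hp₀ : p₀ ∈ G.benchmark) {b₁ b₃ : ℝ}
    (hb₁ : ∑ x ∈ PO ×ˢ (Finset.univ : Finset A), bias (S.oracleCell O x.1 x.2) π y ≤ b₁)
    (hb₃ : ∑ a, bias (S.responseCell p₀ a) π y ≤ b₃) :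
    S.payoff L y (fun _ => p₀) π - S.payoff L y (fun t => O (π t)) π ≤ c + γ +
      (b₁ + K * √(PO.card * Fintype.card A / T) +
        2 / β * (εs + K * √(PO.card * Fintype.card A / T) + 2 * b₁)) +
      (b₃ + K * √(Fintype.card A / T) + 2 / ε * (εs + K * √(Fintype.card A / T) + 2 * b₃)) := by
  have h1 := average_optimistic_le_payoff_oracle hβ hγ hO hT hK hswap hsec
  have h2 := payoff_benchmark_le hε hT hK hp₀ hswap hsec
  have hT' : (0 : ℝ) < T := by exact_mod_cast hT
  have h3 : 1 / (T : ℝ) * ∑ t, G.expV (S.aopt p₀ (π t)) p₀ (π t) ≤ 1 / (T : ℝ) *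
      ∑ t, (G.expV (S.astar (O (π t)) (π t)) (O (π t)) (π t) - γ) + (c + γ) := by
    have h4 : ∑ t, G.expV (S.aopt p₀ (π t)) p₀ (π t) ≤
        ∑ t, ((G.expV (S.astar (O (π t)) (π t)) (O (π t)) (π t) - γ) + (c + γ)) :=
      Finset.sum_le_sum fun t _ => by linarith [(hO (π t)).2.2 p₀ hp₀]
    have h5 := mul_le_mul_of_nonneg_left h4 (by positivity : (0 : ℝ) ≤ 1 / T)
    refine h5.trans_eq ?_
    rw [Finset.sum_add_distrib, mul_add, Finset.sum_const, Finset.card_univ, Fintype.card_fin,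
      nsmul_eq_mul, ← mul_assoc, one_div_mul_cancel hT'.ne', one_mul]
  have h6 := mul_le_mul_of_nonneg_left hb₁ (by positivity : 0 ≤ 2 / β)
  have h7 := mul_le_mul_of_nonneg_left hb₃ (by positivity : 0 ≤ 2 / ε)
  linarith

theorem abs_payoff_le_one (hT : 0 < T) (p : Fin T → P) : |S.payoff L y p π| ≤ 1 := by
  have hT' : (0 : ℝ) < T := by exact_mod_cast hT
  have hb : ∀ a : Fin T → A, |1 / (T : ℝ) * ∑ t, G.V (a t) (p t) (y t)| ≤ 1 := by
    intro a
    rw [abs_mul, abs_of_pos (by positivity : (0 : ℝ) < 1 / T), one_div, inv_mul_le_iff₀ hT', mul_one]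
    refine (Finset.abs_sum_le_sum_abs _ _).trans ?_
    simpa using Finset.sum_le_sum fun t (_ : t ∈ Finset.univ) => G.abs_V_le (a t) (p t) (y t)
  have h1 := expect_mono (actionLaw L T y p (S.recommend p π)) (f := fun _ => -1)
    (bounded_of_finite _) (bounded_of_finite _) fun a => (abs_le.1 (hb a)).1
  have h2 := expect_mono (actionLaw L T y p (S.recommend p π)) (g := fun _ => 1)
    (bounded_of_finite _) (bounded_of_finite _) fun a => (abs_le.1 (hb a)).2
  rw [expect_const] at h1 h2
  exact abs_le.2 ⟨h1, h2⟩

theorem abs_regretGiven_le_two (hT : 0 < T) : |S.regretGiven O L y π| ≤ 2 := by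
  have h := fun p => abs_le.1 (abs_payoff_le_one (S := S) (L := L) (y := y) (π := π) hT p)
  have h' := h fun t => O (π t)
  obtain ⟨p₀, hp₀⟩ := G.benchmark_nonempty
  rw [abs_le]
  constructor
  · refine le_trans ?_ (Finset.le_sup' (fun p₀ => S.payoff L y (fun _ => p₀) π -
      S.payoff L y (fun t => O (π t)) π) hp₀)
    linarith [(h fun _ => p₀).1]
  · refine Finset.sup'_le _ _ fun p₀ _ => ?_
    linarith [(h fun _ => p₀).2]

theorem card_events_le (S : Selection G ε) (PO : Finset P) (O : Belief Y → P) :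
    (S.events PO O).card ≤
      PO.card * Fintype.card A + 2 * (G.benchmark.card * Fintype.card A) := by
  classical
  have h1 : (S.events1 PO O).card ≤ PO.card * Fintype.card A :=
    Finset.card_image_le.trans_eq (by rw [Finset.card_product, Finset.card_univ])
  have h2 : S.events2.card ≤ G.benchmark.card * Fintype.card A :=
    Finset.card_image_le.trans_eq (by rw [Finset.card_product, Finset.card_univ])
  have h3 : S.events3.card ≤ G.benchmark.card * Fintype.card A :=
    Finset.card_biUnion_le_card_mul _ _ _ fun p₀ _ => Finset.card_image_le
  have h := Finset.card_union_le (S.events1 PO O ∪ S.events2) S.events3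
  have h' := Finset.card_union_le (S.events1 PO O) S.events2
  unfold Selection.events
  omega

theorem oracleCell_mem_events (S : Selection G ε) {PO : Finset P} (O : Belief Y → P) {q : P}
    (hq : q ∈ PO) (s : A) : S.oracleCell O q s ∈ S.events PO O := by
  classical
  exact Finset.mem_union_left _ (Finset.mem_union_left _
    (Finset.mem_image.2 ⟨(q, s), by simp [hq], rfl⟩))

theorem responseCell_mem_events3At (S : Selection G ε) (q : P) (s : A) :
    S.responseCell q s ∈ S.events3At q := by
  classical
  exact Finset.mem_image.2 ⟨s, Finset.mem_univ _, rfl⟩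

theorem events3At_subset_events (S : Selection G ε) (PO : Finset P) (O : Belief Y → P) {q : P}
    (hq : q ∈ G.benchmark) : S.events3At q ⊆ S.events PO O := by
  classical
  exact fun E hE => Finset.mem_union_right _ (Finset.mem_biUnion.2 ⟨q, hq, hE⟩)

theorem bias_empty (π : Fin T → Belief Y) (y : Fin T → Y) : bias ∅ π y = 0 := by
  simp [bias_eq, deviation]

/-- Cells are indexed by pairs, but `events1` is a set of sets. Distinct pairs have disjoint cells,
so only empty cells can coincide, and their bias is 0. -/
theorem sum_bias_oracleCell_le {α : Set (Belief Y) → ℝ}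
    (hα : HasConditionalBias (S.events PO O) α π y) :
    ∑ x ∈ PO ×ˢ (Finset.univ : Finset A), bias (S.oracleCell O x.1 x.2) π y ≤
      ∑ E ∈ S.events1 PO O, α E := by
  classical
  refine le_trans (Finset.sum_image_of_disjoint (f := fun x : P × A => S.oracleCell O x.1 x.2)
    (g := fun E => bias E π y) (bias_empty π y) ?_).ge (Finset.sum_le_sum fun E hE => hα E ?_)
  · intro x _ z _ hxz
    refine Set.disjoint_left.2 fun q h1 h2 => hxz (Prod.ext ?_ ?_)
    · exact h1.1.symm.trans h2.1
    · exact h1.2.symm.trans h2.2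
  · exact Finset.mem_union_left _ (Finset.mem_union_left _ hE)

theorem sum_bias_responseCell_le {α : Set (Belief Y) → ℝ}
    (hα : HasConditionalBias (S.events PO O) α π y) {p₀ : P} (hp₀ : p₀ ∈ G.benchmark) :
    ∑ a, bias (S.responseCell p₀ a) π y ≤ ∑ E ∈ S.events3At p₀, α E := by
  classical
  refine le_trans (Finset.sum_image_of_disjoint (f := fun a => S.responseCell p₀ a)
    (g := fun E => bias E π y) (bias_empty π y) ?_).ge (Finset.sum_le_sum fun E hE => hα E ?_)
  · intro x _ z _ hxz
    exact Set.disjoint_left.2 fun q h1 h2 => hxz (h1.symm.trans h2)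
  · exact events3At_subset_events S PO O hp₀ hE

/-- All cells share one excess, multiplied by the number of cells, while Cauchy–Schwarz bounds the
sum of the square root terms. The result is affine in the excess, as needed for taking expectations.
-/
theorem sum_bias_le_of_biasExcess {κ : ℝ} (hκ : 0 ≤ κ) (hT : 0 < T)
    {𝓔 : Finset (Set (Belief Y))} (hl : 0 ≤ Real.log ((Fintype.card Y : ℝ) * 𝓔.card * T))
    {p : Fin T → P} {r : Fin T → A} {Q : Finset P} (hQ : ∀ t, p t ∈ Q)
    {E : P → A → Set (Belief Y)} (hE : ∀ q ∈ Q, ∀ s t, π t ∈ E q s ↔ p t = q ∧ r t = s)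
    (hmem : ∀ q ∈ Q, ∀ s, E q s ∈ 𝓔) :
    ∑ x ∈ Q ×ˢ (Finset.univ : Finset A), bias (E x.1 x.2) π y ≤
      κ * Fintype.card Y * √(Real.log ((Fintype.card Y : ℝ) * 𝓔.card * T)) *
        √(Q.card * Fintype.card A / T) + Q.card * Fintype.card A * biasExcess κ 𝓔 π y := by
  classical
  have hT' : (0 : ℝ) < T := by exact_mod_cast hT
  set l := Real.log ((Fintype.card Y : ℝ) * 𝓔.card * T)
  have hits_eq : ∀ q ∈ Q, ∀ s, hits (E q s) π = (rounds p r q s).card := by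
    intro q hq s
    unfold hits rounds
    congr 1
    ext t
    simp [hE q hq s t]
  calc ∑ x ∈ Q ×ˢ (Finset.univ : Finset A), bias (E x.1 x.2) π y
      ≤ ∑ x ∈ Q ×ˢ (Finset.univ : Finset A), (κ * Fintype.card Y * √l / T *
          √((rounds p r x.1 x.2).card : ℝ) + biasExcess κ 𝓔 π y) := by
        refine Finset.sum_le_sum fun x hx => ?_
        have hq := (Finset.mem_product.1 hx).1
        have h := le_biasExcess κ (hmem _ hq x.2) π y
        rw [hits_eq _ hq, Real.sqrt_mul hl] at h
        have e : κ * Fintype.card Y * (√l * √((rounds p r x.1 x.2).card : ℝ)) / T =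
          κ * Fintype.card Y * √l / T * √((rounds p r x.1 x.2).card : ℝ) := by ring
        linarith
    _ = κ * Fintype.card Y * √l / T * ∑ x ∈ Q ×ˢ (Finset.univ : Finset A),
          √((rounds p r x.1 x.2).card : ℝ) + Q.card * Fintype.card A * biasExcess κ 𝓔 π y := by
        rw [Finset.sum_add_distrib, ← Finset.mul_sum, Finset.sum_const, Finset.card_product,
          Finset.card_univ, nsmul_eq_mul, Nat.cast_mul]
    _ ≤ κ * Fintype.card Y * √l / T * (T * √(Q.card * Fintype.card A / T)) +
          Q.card * Fintype.card A * biasExcess κ 𝓔 π y := by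
        gcongr
        exact sum_sqrt_card_rounds_le p r hQ
    _ = _ := by field_simp

end Regret

/-! ### The two regret bounds -/

section Bounds

variable {P A Y : Type*} [Fintype Y] {G : Game P A Y} {ε : ℝ} {T : ℕ}
  {S : Selection G ε} {c β γ K : ℝ} {PO : Finset P} {O : Belief Y → P}
  {L : AgentAlgorithm P A Y} {y : Fin T → Y} {π : Fin T → Belief Y} {εs : ℝ}

theorem Selection.nonempty_action [Nonempty Y] (S : Selection G ε) : Nonempty A := by
  classical
  obtain ⟨p₀, _⟩ := G.benchmark_nonempty
  exact ⟨S.astar p₀ ⟨Pi.single (Classical.arbitrary Y) 1, single_mem_stdSimplex ℝ _⟩⟩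

theorem Selection.IsOptimalStableOracle.nonempty [Nonempty Y]
    (hO : S.IsOptimalStableOracle c β γ PO O) : PO.Nonempty := by
  classical
  exact ⟨_, (hO ⟨Pi.single (Classical.arbitrary Y) 1, single_mem_stdSimplex ℝ _⟩).1⟩

theorem Selection.IsOptimalStableOracle.neg_two_le [Nonempty Y]
    (hO : S.IsOptimalStableOracle c β γ PO O) : -2 ≤ c := by
  classical
  obtain ⟨p₀, hp₀⟩ := G.benchmark_nonempty
  set q : Belief Y := ⟨Pi.single (Classical.arbitrary Y) 1, single_mem_stdSimplex ℝ _⟩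
  have h := (hO q).2.2 p₀ hp₀
  have h1 := (abs_le.1 (G.abs_expV_le (S.aopt p₀ q) p₀ q)).1
  have h2 := (abs_le.1 (G.abs_expV_le (S.astar (O q) q) (O q) q)).2
  linarith

variable [Fintype A]

theorem NoSwapRegret.nonneg {ψ : Belief Y → P} (h : S.NoSwapRegret ψ L εs y π) : 0 ≤ εs :=
  (swapRegret_nonneg G _ _ _ _).trans h.1

theorem sqrt_actions_le [Nonempty Y] (hO : S.IsOptimalStableOracle c β γ PO O) :
    √(Fintype.card A / T : ℝ) ≤ √(PO.card * Fintype.card A / T : ℝ) := by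
  have h : (1 : ℝ) ≤ PO.card := by exact_mod_cast hO.nonempty.card_pos
  apply Real.sqrt_le_sqrt
  gcongr
  exact le_mul_of_one_le_left (Nat.cast_nonneg _) h

/-- The policy regret for given forecasts with arbitrary conditional bias. -/
theorem regretGiven_le_of_bias [Nonempty Y] (hε : 0 < ε) (hβ : 0 < β) (hβ2 : β ≤ 2)
    (hγ : 0 ≤ γ) (hO : S.IsOptimalStableOracle c β γ PO O) (hT : 0 < T) (hK : 0 ≤ K)
    {α : Set (Belief Y) → ℝ} (hα : HasConditionalBias (S.events PO O) α π y)
    (hswap : S.NoSwapRegret O L εs y π) (hsec : S.NoSecretInfo O L K y π) {C : ℝ}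
    (hC : 4 + 6 * K ≤ C) :
    S.regretGiven O L y π ≤
      c + 3 * (∑ E ∈ S.events1 PO O, α E) + 2 * (∑ E ∈ S.events2, α E)
        + G.benchmark.sup' G.benchmark_nonempty (fun p₀ => ∑ E ∈ S.events3At p₀, α E) + γ
        + C * (εs + √((PO.card : ℝ) * Fintype.card A / T) + ∑ E ∈ S.events1 PO O, α E) / β
        + C * (εs + √((Fintype.card A : ℝ) / T)
            + G.benchmark.sup' G.benchmark_nonempty
                (fun p₀ => ∑ E ∈ S.events3At p₀, α E)) / ε := by
  have hα0 : ∀ E ∈ S.events PO O, 0 ≤ α E := fun E hE => (bias_nonneg E π y).trans (hα E hE)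
  have hα1 : 0 ≤ ∑ E ∈ S.events1 PO O, α E := Finset.sum_nonneg fun E hE =>
    hα0 E (Finset.mem_union_left _ (Finset.mem_union_left _ hE))
  have hα2 : 0 ≤ ∑ E ∈ S.events2, α E := Finset.sum_nonneg fun E hE =>
    hα0 E (Finset.mem_union_left _ (Finset.mem_union_right _ hE))
  have hsup : ∀ p₀ ∈ G.benchmark, ∑ E ∈ S.events3At p₀, α E ≤
      G.benchmark.sup' G.benchmark_nonempty (fun p₀ => ∑ E ∈ S.events3At p₀, α E) :=
    fun p₀ hp₀ => Finset.le_sup' (fun p₀ => ∑ E ∈ S.events3At p₀, α E) hp₀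
  have hα3 : 0 ≤ G.benchmark.sup' G.benchmark_nonempty (fun p₀ => ∑ E ∈ S.events3At p₀, α E) := by
    obtain ⟨p₀, hp₀⟩ := G.benchmark_nonempty
    exact (Finset.sum_nonneg fun E hE => hα0 E (events3At_subset_events S PO O hp₀ hE)).trans
      (hsup p₀ hp₀)
  set α₁ := ∑ E ∈ S.events1 PO O, α E
  set α₂ := ∑ E ∈ S.events2, α E
  set α₃ := G.benchmark.sup' G.benchmark_nonempty (fun p₀ => ∑ E ∈ S.events3At p₀, α E)
  refine Finset.sup'_le _ _ fun p₀ hp₀ => ?_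
  have h := regret_benchmark_le hε hβ hγ hO hT hK hswap hsec hp₀ (sum_bias_oracleCell_le hα)
    ((sum_bias_responseCell_le hα hp₀).trans (hsup p₀ hp₀))
  have hs := sqrt_actions_le (T := T) hO
  have hs0 := Real.sqrt_nonneg (Fintype.card A / T : ℝ)
  set s₁ := √(PO.card * Fintype.card A / T : ℝ)
  set s₃ := √(Fintype.card A / T : ℝ)
  have hεs := NoSwapRegret.nonneg hswap
  have hKs := mul_le_mul_of_nonneg_left hs hK
  have hKs3 := mul_nonneg hK hs0
  -- The terms in `K` without denominator, from both payoffs, are moved into the `1 / β` term using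
  -- `β ≤ 2`; this produces the 6 in `4 + 6 * K`.
  have h1 : 2 * (K * s₁) + 2 / β * (εs + K * s₁ + 2 * α₁) ≤ C * (εs + s₁ + α₁) / β := by
    rw [div_mul_eq_mul_div, ← le_sub_iff_add_le, ← sub_div, le_div_iff₀ hβ]
    have h3 : (4 + 6 * K) * (εs + s₁ + α₁) ≤ C * (εs + s₁ + α₁) := by gcongr
    have h4 := mul_le_mul_of_nonneg_left hβ2 (hKs3.trans hKs)
    have h5 := mul_nonneg hK hεs
    have h6 := mul_nonneg hK hα1
    linarith
  have h2 : 2 / ε * (εs + K * s₃ + 2 * α₃) ≤ C * (εs + s₃ + α₃) / ε := by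
    rw [div_mul_eq_mul_div]
    refine div_le_div_of_nonneg_right ?_ hε.le
    have h3 : (4 + 6 * K) * (εs + s₃ + α₃) ≤ C * (εs + s₃ + α₃) := by gcongr
    have h5 := mul_nonneg hK hεs
    have h6 := mul_nonneg hK hα3
    linarith
  change S.payoff L y (fun _ => p₀) π - S.payoff L y (fun t => O (π t)) π ≤ _
  linarith

theorem sqrt_log_add_log_le {n Λ : ℝ} (hΛ : 1 ≤ Λ) (h0 : 0 ≤ n) (h : n ≤ 2 * Λ) :
    √n + n ≤ 4 * Λ := by
  have : √n ≤ (1 + n) / 2 := by nlinarith [Real.sq_sqrt h0, sq_nonneg (√n - 1)]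
  linarith

theorem one_le_card_product [Nonempty Y] (hO : S.IsOptimalStableOracle c β γ PO O) (hT : 0 < T) :
    (1 : ℝ) ≤ (T : ℝ) * Fintype.card Y * PO.card * G.benchmark.card * Fintype.card A := by
  have hA : Nonempty A := S.nonempty_action
  have h : 0 < T * Fintype.card Y * PO.card * G.benchmark.card * Fintype.card A :=
    Nat.mul_pos (Nat.mul_pos (Nat.mul_pos (Nat.mul_pos hT Fintype.card_pos)
      hO.nonempty.card_pos) G.benchmark_nonempty.card_pos) Fintype.card_pos
  exact_mod_cast h

theorem events_nonempty [Nonempty Y] (hO : S.IsOptimalStableOracle c β γ PO O) :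
    (S.events PO O).Nonempty := by
  obtain ⟨q, hq⟩ := hO.nonempty
  have hA : Nonempty A := S.nonempty_action
  exact ⟨_, oracleCell_mem_events S O hq (Classical.arbitrary A)⟩

theorem log_events_nonneg [Nonempty Y] (hO : S.IsOptimalStableOracle c β γ PO O) (hT : 0 < T) :
    0 ≤ Real.log ((Fintype.card Y : ℝ) * (S.events PO O).card * T) := by
  have h : 0 < Fintype.card Y * (S.events PO O).card * T :=
    Nat.mul_pos (Nat.mul_pos Fintype.card_pos (events_nonempty hO).card_pos) hT
  exact Real.log_nonneg (by exact_mod_cast h)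

theorem log_events_le [Nonempty Y] (hO : S.IsOptimalStableOracle c β γ PO O) (hT : 0 < T) :
    Real.log ((Fintype.card Y : ℝ) * (S.events PO O).card * T) ≤
      2 * (1 + Real.log ((T : ℝ) * Fintype.card Y * PO.card * G.benchmark.card *
        Fintype.card A)) := by
  have hM1 := one_le_card_product (T := T) hO hT
  have hPO := hO.nonempty.card_pos
  have hP := G.benchmark_nonempty.card_pos
  have hcard : (S.events PO O).card ≤
      3 * (PO.card * G.benchmark.card * Fintype.card A) := by
    refine (card_events_le S PO O).trans ?_
    have h1 := Nat.mul_le_mul_right (Fintype.card A) (Nat.le_mul_of_pos_right PO.card hP)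
    have h2 := Nat.mul_le_mul_right (Fintype.card A) (Nat.le_mul_of_pos_left G.benchmark.card hPO)
    omega
  have hle : (Fintype.card Y : ℝ) * (S.events PO O).card * T ≤
      3 * ((T : ℝ) * Fintype.card Y * PO.card * G.benchmark.card * Fintype.card A) := by
    calc _ ≤ (Fintype.card Y : ℝ) * (3 * (PO.card * G.benchmark.card * Fintype.card A)) * T := by
          gcongr
          exact_mod_cast hcard
      _ = _ := by ring
  have hpos : (0 : ℝ) < (Fintype.card Y : ℝ) * (S.events PO O).card * T := by
    have h : 0 < Fintype.card Y * (S.events PO O).card * T :=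
      Nat.mul_pos (Nat.mul_pos Fintype.card_pos (events_nonempty hO).card_pos) hT
    exact_mod_cast h
  have h1 := Real.log_le_log hpos hle
  have h2 := Real.log_mul (three_ne_zero (α := ℝ)) (by linarith : (T : ℝ) * Fintype.card Y *
    PO.card * G.benchmark.card * Fintype.card A ≠ 0)
  have h3 := Real.log_le_sub_one_of_pos (show (0 : ℝ) < 3 by norm_num)
  have h4 := Real.log_nonneg hM1
  linarith

/-- The right side does not depend on the benchmark policy, so the maximum inside the expectation
costs nothing extra. -/
theorem regretGiven_le_of_biasExcess [Nonempty Y] (hε : 0 < ε) (hβ : 0 < β)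
    (hγ : 0 ≤ γ) (hO : S.IsOptimalStableOracle c β γ PO O) (hT : 0 < T) (hK : 0 ≤ K)
    {κ : ℝ} (hκ : 0 ≤ κ) (hswap : S.NoSwapRegret O L εs y π) (hsec : S.NoSecretInfo O L K y π)
    {b₁ b₃ : ℝ}
    (hb₁ : κ * Fintype.card Y * √(Real.log ((Fintype.card Y : ℝ) * (S.events PO O).card * T)) *
      √(PO.card * Fintype.card A / T) +
      PO.card * Fintype.card A * biasExcess κ (S.events PO O) π y = b₁)
    (hb₃ : κ * Fintype.card Y * √(Real.log ((Fintype.card Y : ℝ) * (S.events PO O).card * T)) *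
      √(Fintype.card A / T) + Fintype.card A * biasExcess κ (S.events PO O) π y = b₃) :
    S.regretGiven O L y π ≤ c + γ + (b₁ + K * √(PO.card * Fintype.card A / T) +
        2 / β * (εs + K * √(PO.card * Fintype.card A / T) + 2 * b₁)) +
      (b₃ + K * √(Fintype.card A / T) + 2 / ε * (εs + K * √(Fintype.card A / T) + 2 * b₃)) := by
  have hl0 := log_events_nonneg hO hT
  refine Finset.sup'_le _ _ fun p₀ hp₀ => ?_
  refine regret_benchmark_le hε hβ hγ hO hT hK hswap hsec hp₀ ?_ ?_
  · rw [← hb₁]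
    exact sum_bias_le_of_biasExcess hκ hT hl0 (p := fun t => O (π t))
      (r := fun t => S.astar (O (π t)) (π t)) (fun t => (hO (π t)).1)
      (fun q _ s t => Iff.rfl) fun q hq s => oracleCell_mem_events S O hq s
  · rw [← hb₃]
    have h := sum_bias_le_of_biasExcess (κ := κ) (y := y) hκ hT hl0
      (p := fun _ => p₀) (r := fun t => S.astar p₀ (π t)) (Q := {p₀}) (E := S.responseCell)
      (fun t => Finset.mem_singleton_self _)
      (fun q hq s t => by rw [Finset.mem_singleton.1 hq]; exact (and_iff_right rfl).symm)
      fun q hq s => by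
        rw [Finset.mem_singleton.1 hq]
        exact events3At_subset_events S PO O hp₀ (responseCell_mem_events3At S p₀ s)
    simpa only [Finset.sum_product, Finset.sum_singleton, Finset.card_singleton, Nat.cast_one,
      one_mul] using h

theorem expect_le_of_affine {Ω : Type*} (μ : PMF Ω) {f Z : Ω → ℝ} (hf : ∃ M, ∀ x, |f x| ≤ M)
    (hZ : ∃ M, ∀ x, |Z x| ≤ M) {d₀ d₁ z : ℝ} (hd₁ : 0 ≤ d₁)
    (h : ∀ x ∈ μ.support, f x ≤ d₀ + d₁ * Z x) (hz : expect μ Z ≤ z) :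
    expect μ f ≤ d₀ + d₁ * z := by
  obtain ⟨M, hM⟩ := hZ
  have hdZ : ∃ M, ∀ x, |d₁ * Z x| ≤ M := ⟨|d₁| * M, fun x => by
    rw [abs_mul]; exact mul_le_mul_of_nonneg_left (hM x) (abs_nonneg _)⟩
  have hsum : ∃ M, ∀ x, |d₀ + d₁ * Z x| ≤ M := by
    obtain ⟨M', hM'⟩ := hdZ
    exact ⟨|d₀| + M', fun x => (abs_add_le _ _).trans (add_le_add le_rfl (hM' x))⟩
  refine (expect_mono_of_support μ hf hsum h).trans ?_
  rw [expect_add μ ⟨_, fun _ => le_rfl⟩ hdZ, expect_const, expect_const_mul]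
  exact add_le_add le_rfl (mul_le_mul_of_nonneg_left hz hd₁)

/-- Covers the expected bias on a family of `N` cells: the expected excess, multiplied by `N`, is
absorbed into the square root term once `N / T ≤ s`. -/
theorem bias_sum_bound {m T l Λ N s : ℝ} (hm : 0 ≤ m) (hl : 0 ≤ l) (hΛ : 1 ≤ Λ) (hlΛ : l ≤ 2 * Λ)
    (hs : 0 ≤ s) (hNs : N / T ≤ s) :
    10 * m * √l * s + N * (10 * m * l / T) ≤ 40 * (Λ * (m * s)) := by
  have h := sqrt_log_add_log_le hΛ hl hlΛ
  calc 10 * m * √l * s + N * (10 * m * l / T)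
      = 10 * m * √l * s + 10 * m * l * (N / T) := by ring
    _ ≤ 10 * m * √l * s + 10 * m * l * s := by gcongr
    _ = 10 * m * (√l + l) * s := by ring
    _ ≤ 10 * m * (4 * Λ) * s := by gcongr
    _ = _ := by ring

/-- Collecting the terms of the regret bound. -/
theorem regret_terms_le {ε β K C εs s₁ s₃ b₁ b₃ X₁ X₃ : ℝ} (hε : 0 < ε) (hβ : 0 < β)
    (hβ2 : β ≤ 2) (hK : 0 ≤ K) (hC : 320 + 6 * K ≤ C) (hεs : 0 ≤ εs) (hs₃ : 0 ≤ s₃)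
    (h₁ : s₁ ≤ X₁) (h₃ : s₃ ≤ X₃) (hX : X₃ ≤ X₁) (hb₁ : b₁ ≤ 40 * X₁) (hb₃ : b₃ ≤ 40 * X₃) :
    (b₁ + K * s₁ + 2 / β * (εs + K * s₁ + 2 * b₁)) +
      (b₃ + K * s₃ + 2 / ε * (εs + K * s₃ + 2 * b₃)) ≤
      C * ((εs + X₁) / β) + C * ((εs + X₃) / ε) := by
  have hX₃ := hs₃.trans h₃
  have hX₁ := hX₃.trans hX
  have hKs₁ := mul_le_mul_of_nonneg_left h₁ hK
  have hKs₃ := mul_le_mul_of_nonneg_left h₃ hK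
  have hKX := mul_le_mul_of_nonneg_left hX hK
  have hKX₁ := mul_nonneg hK hX₁
  have hKX₃ := mul_nonneg hK hX₃
  have hKε := mul_nonneg hK hεs
  have h1 : (b₁ + K * s₁ + b₃ + K * s₃) + 2 / β * (εs + K * s₁ + 2 * b₁) ≤
      C * ((εs + X₁) / β) := by
    have h5 := mul_le_mul_of_nonneg_right hC (add_nonneg hεs hX₁)
    have h6 : b₁ + K * s₁ + b₃ + K * s₃ ≤ 80 * X₁ + 2 * (K * X₁) := by linarith
    -- Terms without denominator again go into the `1 / β` term: `2 * 80` from here and `2 * 2 * 40`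
    -- from the penalized bias give 320.
    have h7 := mul_le_mul_of_nonneg_left hβ2 (by linarith : 0 ≤ 80 * X₁ + 2 * (K * X₁))
    have h8 := mul_le_mul_of_nonneg_right h6 hβ.le
    rw [← mul_div_assoc, div_mul_eq_mul_div, ← le_sub_iff_add_le, ← sub_div, le_div_iff₀ hβ]
    linarith
  have h2 : 2 / ε * (εs + K * s₃ + 2 * b₃) ≤ C * ((εs + X₃) / ε) := by
    have h5 := mul_le_mul_of_nonneg_right hC (add_nonneg hεs hX₃)
    rw [← mul_div_assoc, div_mul_eq_mul_div]
    refine div_le_div_of_nonneg_right ?_ hε.le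
    linarith
  linarith

/-- The policy regret of a forecaster with the conditional bias guarantee. -/
theorem regret_le_of_hasBiasGuarantee [Nonempty Y] (hε : 0 < ε) (hβ : 0 < β) (hβ2 : β ≤ 2)
    (hγ : 0 ≤ γ) (hO : S.IsOptimalStableOracle c β γ PO O) (hT : 0 < T) (hK : 0 ≤ K)
    {F : Forecaster Y} (hF : HasBiasGuarantee 10 F (S.events PO O) T)
    (hbeh : ∀ π ∈ (forecastLaw F T y).support,
      S.NoSwapRegret O L εs y π ∧ S.NoSecretInfo O L K y π) {C : ℝ} (hC : 320 + 6 * K ≤ C) :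
    S.regret F O L y ≤ c + γ + C *
      ((1 + Real.log ((T : ℝ) * Fintype.card Y * PO.card * G.benchmark.card *
            Fintype.card A)) * √((G.benchmark.card : ℝ) * Fintype.card A / T)
        + (εs + (1 + Real.log ((T : ℝ) * Fintype.card Y * PO.card * G.benchmark.card *
            Fintype.card A)) * (Fintype.card Y * √((PO.card : ℝ) * Fintype.card A / T))) / β
        + (εs + (1 + Real.log ((T : ℝ) * Fintype.card Y * PO.card * G.benchmark.card *
            Fintype.card A)) * (Fintype.card Y * √((Fintype.card A : ℝ) / T))) / ε) := by
  have hl0 := log_events_nonneg hO hT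
  have hlΛ := log_events_le hO hT
  have hΛ1 : 1 ≤ 1 + Real.log ((T : ℝ) * Fintype.card Y * PO.card * G.benchmark.card *
      Fintype.card A) := le_add_of_nonneg_right (Real.log_nonneg (one_le_card_product hO hT))
  generalize 1 + Real.log ((T : ℝ) * Fintype.card Y * PO.card * G.benchmark.card *
    Fintype.card A) = Λ at hlΛ hΛ1 ⊢
  have hY1 : (1 : ℝ) ≤ Fintype.card Y := by exact_mod_cast Fintype.card_pos
  have hs := sqrt_actions_le (T := T) hO
  have hs₃ := Real.sqrt_nonneg (Fintype.card A / T : ℝ)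
  have hs₁ := hs₃.trans hs
  have hεs : 0 ≤ εs := by
    obtain ⟨π, hπ⟩ := (forecastLaw F T y).support_nonempty
    exact NoSwapRegret.nonneg (hbeh π hπ).1
  have hscale : ∀ s : ℝ, 0 ≤ s → s ≤ Λ * (Fintype.card Y * s) := fun s h0 => by
    have h1 := mul_le_mul_of_nonneg_right hY1 h0
    have h2 := mul_le_mul_of_nonneg_right hΛ1 (by positivity : 0 ≤ Fintype.card Y * s)
    linarith
  have hX₁ := hscale _ hs₁
  have hX₃ := hscale _ hs₃
  have hΛs₀ : 0 ≤ C * (Λ * √((G.benchmark.card : ℝ) * Fintype.card A / T)) :=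
    mul_nonneg (by linarith) (by positivity)
  have hregb : ∃ M, ∀ π : Fin T → Belief Y, |S.regretGiven O L y π| ≤ M :=
    ⟨2, fun π => abs_regretGiven_le_two hT⟩
  rw [mul_add, mul_add]
  -- At most 1, this ratio is below its square root, which absorbs the excess. Above 1, the regret
  -- is at most 2, `c ≥ -2`, and the `1 / β` term alone is at least `C / 2 ≥ 160`.
  rcases le_total (PO.card * Fintype.card A / T : ℝ) 1 with hsmall | hlarge
  · have hroot : ∀ x : ℝ, 0 ≤ x → x ≤ 1 → x ≤ √x := fun x h0 h1 =>
      Real.le_sqrt_of_sq_le (by nlinarith)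
    have hPO1 : (1 : ℝ) ≤ PO.card := by exact_mod_cast hO.nonempty.card_pos
    have hsmall' : (Fintype.card A / T : ℝ) ≤ 1 := by
      refine le_trans ?_ hsmall
      gcongr
      exact le_mul_of_one_le_left (Nat.cast_nonneg _) hPO1
    have hb₁ := bias_sum_bound (Nat.cast_nonneg (Fintype.card Y)) hl0 hΛ1 hlΛ hs₁
      (hroot _ (by positivity) hsmall)
    have hb₃ := bias_sum_bound (Nat.cast_nonneg (Fintype.card Y)) hl0 hΛ1 hlΛ hs₃
      (hroot _ (by positivity) hsmall')
    have hterms := regret_terms_le hε hβ hβ2 hK hC hεs hs₃ hX₁ hX₃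
      (by gcongr : Λ * (Fintype.card Y * √(Fintype.card A / T : ℝ)) ≤
        Λ * (Fintype.card Y * √(PO.card * Fintype.card A / T : ℝ))) hb₁ hb₃
    have hpt := fun π hπ => regretGiven_le_of_biasExcess hε hβ hγ hO hT hK (κ := 10)
      (by norm_num) (hbeh π hπ).1 (hbeh π hπ).2 rfl rfl
    have hexp : expect (forecastLaw F T y) (fun π => biasExcess 10 (S.events PO O) π y) ≤
      10 * (Fintype.card Y : ℝ) *
        Real.log ((Fintype.card Y : ℝ) * (S.events PO O).card * T) / T := hF y
    have hZb := biasExcess_bounded (κ := 10) (by norm_num) hT (events_nonempty hO) y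
    generalize 10 * (Fintype.card Y : ℝ) *
      √(Real.log ((Fintype.card Y : ℝ) * (S.events PO O).card * T)) = B at *
    generalize 10 * (Fintype.card Y : ℝ) *
      Real.log ((Fintype.card Y : ℝ) * (S.events PO O).card * T) / T = z at *
    generalize √(PO.card * Fintype.card A / T : ℝ) = s₁ at *
    generalize √(Fintype.card A / T : ℝ) = s₃ at *
    have hN₁ : (0 : ℝ) ≤ PO.card * Fintype.card A := by positivity
    have hN₃ : (0 : ℝ) ≤ Fintype.card A := by positivity
    generalize (PO.card * Fintype.card A : ℝ) = N₁ at *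
    generalize (Fintype.card A : ℝ) = N₃ at *
    -- `d₀` collects the square root parts of the biases and `d₁` the coefficient of the excess,
    -- both with and without the penalties.
    have hreg := expect_le_of_affine (forecastLaw F T y) hregb hZb
      (d₀ := c + γ + (B * s₁ + K * s₁ + 2 / β * (εs + K * s₁ + 2 * (B * s₁))) +
        (B * s₃ + K * s₃ + 2 / ε * (εs + K * s₃ + 2 * (B * s₃))))
      (d₁ := N₁ + 2 / β * (2 * N₁) + (N₃ + 2 / ε * (2 * N₃))) (by positivity)
      (fun π hπ => (hpt π hπ).trans_eq (by ring)) hexp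
    refine hreg.trans ?_
    linarith
  · have h2 : S.regret F O L y ≤ 2 := by
      refine (expect_mono _ (g := fun _ => 2) hregb ⟨2, by simp⟩ fun π => ?_).trans_eq
        (expect_const _ _)
      exact (le_abs_self _).trans (abs_regretGiven_le_two hT)
    have hc := hO.neg_two_le
    have hs1 := Real.one_le_sqrt.2 hlarge
    have hfrac : 1 / 2 ≤ (εs + Λ * (Fintype.card Y * √(PO.card * Fintype.card A / T : ℝ))) / β := by
      rw [le_div_iff₀ hβ]
      linarith
    have h4 := mul_le_mul (by linarith : 320 ≤ C) hfrac (by norm_num) (by linarith)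
    have hfε : 0 ≤ C * ((εs + Λ * (Fintype.card Y * √(Fintype.card A / T : ℝ))) / ε) :=
      mul_nonneg (by linarith) (by positivity)
    linarith

end Bounds

end PrincipalAgent

end

theorem theorem2 :
    ∃ κ : ℝ, 0 < κ ∧ ∀ K : ℝ, 0 ≤ K → ∃ C : ℝ, 0 < C ∧
    ∀ (P A Y : Type*) [Fintype A] [Fintype Y] [Nonempty Y] (G : PrincipalAgent.Game P A Y)
      (c ε β γ : ℝ) (_ : 0 < ε) (_ : 0 < β) (_ : β ≤ 2) (_ : 0 ≤ γ)
      (S : PrincipalAgent.Selection G ε) (PO : Finset P) (O : PrincipalAgent.Belief Y → P)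
      (_ : S.IsOptimalStableOracle c β γ PO O) (T : ℕ) (_ : 0 < T),
      -- there are only polynomially many events
      (S.events PO O).card ≤ PO.card * Fintype.card A + 2 * (G.benchmark.card * Fintype.card A) ∧
      -- there is a forecaster with the conditional bias guarantee for these events
      (∃ F : PrincipalAgent.Forecaster Y,
        PrincipalAgent.HasBiasGuarantee κ F (S.events PO O) T) ∧
      -- running any such forecaster and following the oracle gives low policy regret
      (∀ F : PrincipalAgent.Forecaster Y,
        PrincipalAgent.HasBiasGuarantee κ F (S.events PO O) T →
        ∀ (L : PrincipalAgent.AgentAlgorithm P A Y) (y : Fin T → Y) (εswap : ℝ),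
          (∀ π ∈ (PrincipalAgent.forecastLaw F T y).support,
            S.NoSwapRegret O L εswap y π ∧ S.NoSecretInfo O L K y π) →
          S.regret F O L y ≤ c + γ + C *
            ((1 + Real.log ((T : ℝ) * Fintype.card Y * PO.card * G.benchmark.card *
                  Fintype.card A)) * √((G.benchmark.card : ℝ) * Fintype.card A / T)
              + (εswap + (1 + Real.log ((T : ℝ) * Fintype.card Y * PO.card * G.benchmark.card *
                  Fintype.card A)) *
                  (Fintype.card Y * √((PO.card : ℝ) * Fintype.card A / T))) / β
              + (εswap + (1 + Real.log ((T : ℝ) * Fintype.card Y * PO.card * G.benchmark.card *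
                  Fintype.card A)) *
                  (Fintype.card Y * √((Fintype.card A : ℝ) / T))) / ε)) ∧
      -- the version for given forecasts with an arbitrary conditional bias
      (∀ (L : PrincipalAgent.AgentAlgorithm P A Y) (y : Fin T → Y)
        (π : Fin T → PrincipalAgent.Belief Y) (α : Set (PrincipalAgent.Belief Y) → ℝ) (εswap : ℝ),
          PrincipalAgent.HasConditionalBias (S.events PO O) α π y →
          S.NoSwapRegret O L εswap y π → S.NoSecretInfo O L K y π →
          S.regretGiven O L y π ≤
            c + 3 * (∑ E ∈ S.events1 PO O, α E) + 2 * (∑ E ∈ S.events2, α E)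
              + G.benchmark.sup' G.benchmark_nonempty (fun p₀ => ∑ E ∈ S.events3At p₀, α E) + γ
              + C * (εswap + √((PO.card : ℝ) * Fintype.card A / T)
                  + ∑ E ∈ S.events1 PO O, α E) / β
              + C * (εswap + √((Fintype.card A : ℝ) / T)
                  + G.benchmark.sup' G.benchmark_nonempty
                      (fun p₀ => ∑ E ∈ S.events3At p₀, α E)) / ε) := by
  -- Here 10 is the constant of the constructed forecaster, and `320 + 6 * K` also dominates the `4
  -- + 6 * K` required for fixed forecasts.
  refine ⟨10, by norm_num, fun K hK => ⟨320 + 6 * K, by linarith, ?_⟩⟩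
  intro P A Y _ _ _ G c ε β γ hε hβ hβ2 hγ S PO O hO T hT
  refine ⟨PrincipalAgent.card_events_le S PO O, ?_, ?_, ?_⟩
  · exact PrincipalAgent.exists_forecaster_hasBiasGuarantee hT (PrincipalAgent.events_nonempty hO)
  · intro F hF L y εswap hbeh
    exact PrincipalAgent.regret_le_of_hasBiasGuarantee hε hβ hβ2 hγ hO hT hK hF hbeh le_rfl
  · intro L y π α εswap hα hswap hsec
    exact PrincipalAgent.regretGiven_le_of_bias hε hβ hβ2 hγ hO hT hK hα hswap hsec (by linarith)
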